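/- **Setting.** Cars with preferences $a_1,\dots,a_k\in\{1,\dots,m\}$ arrive one after the other on a one-way street with spots $1,\dots,m$; each car parks in the first unoccupied spot at or past its preferred spot, if there is one. The tuple is a $(k,m)$-parking function if every car is able to park; if car $i$ then parks in spot $p_i$, the total displacement is $d(a_1,\dots,a_k)=\sum_i(p_i-a_i)$. A parking function of length $n$ is an $(n,n)$-parking function $\alpha=(a_1,\dots,a_n)$. Its parking game is the game $c_\alpha(S)=d\big((a_i:i\in S)\big)$ for $S\subseteq[n]$ (on the street with $n$ spots), and the Shapley value of $c_\alpha$ is $$\phi_j(c_\alpha)=\frac1{n!}\sum_{\pi\in\mathfrak S_n}\Big(c_\alpha(\{l:\pi(l)\le\pi(j)\})-c_\alpha(\{l:\pi(l)<\pi(j)\})\Big),\qquad j\in[n].$$ For a weakly increasing tuple $\beta$ of nonnegative integers and $s,t,k\in\mathbb N$ let $\mathcal Q(\beta,s,t,k)$ be the number of size-$k$ sub-tuples of $\beta$ (counted by index sets) with all entries at least $s$ which, after subtracting $s-1$ from each entry, are $(k,\max(t-s+1,0))$-parking functions. Let $b_1$ be the first entry of $\beta$, let $\beta_{\hat\imath}$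 be $\beta$ without its $i$th entry, and let $U(\beta)$ be $\beta$ with all entries equal to the minimum increased by one. Put $\Lambda_t(\beta)=|\{b\in\beta:b\ge t+2\}|$, $\Gamma_s(\beta)=|\{b\in\beta:b\le s-2\}|$ and $$\mathcal R(\beta,s,t)=\sum_{\lambda=0}^{\Lambda_t(\beta)}\sum_{\gamma=0}^{\Gamma_s(\beta)}\binom{\Lambda_t(\beta)}{\lambda}\,\mathcal Q(\beta,1,\max(s-2,0),\gamma)\,(t-s+1+\lambda+\gamma)!\,(n-t+s-\lambda-\gamma-2)!,$$ where only terms with $\mathcal Q(\beta,1,\max(s-2,0),\gamma)\neq0$ are taken. **Theorem.** The Shapley value of parking games can be computed in polynomial time, by the following formulas. 1. For all weakly increasing $\beta$ and all $s,t,k\in\mathbb N$ (cases taken in order), $$\mathcal Q(\beta,s,t,k)=\begin{cases}1,&k=0,\\0,&k>t-s+1\text{ or }k>|\beta|,\\ \mathcal Q(\beta_{\hat1},s,t,k),&b_1<s,\\ \mathcal Q(\beta,s+1,t,k),&b_1>s,\\ \mathcal Q(U(\beta)_{\hat1},s+1,t,k-1)+\mathcal Q(\beta_{\hat1},s,t,k),&b_1=s.\end{cases}$$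 2. Let $\alpha$ be a parking function of length $n$, let $\alpha'=(a_1',\dots,a_n')$ be its weakly increasing rearrangement, and let $j\in[n]$ have rank $i$ in $\alpha'$ (so that $a_j=a_i'$). Then $\phi_j(c_\alpha)=N_j(\alpha)/n!$, where $$N_j(\alpha)=\sum_{s=1}^{a_i'}\sum_{t=a_i'}^{n-1}(t-a_i'+1)\,\mathcal Q(\alpha'_{\hat\imath},s,t,t-s+1)\,\mathcal R(\alpha'_{\hat\imath},s,t).$$ 3. There are a single program for a random access machine with logarithmic cost (unbounded addressable memory of natural numbers; addition, truncated subtraction, multiplication, integer division, tests and loops; each operation is charged the bit lengths of the numbers and addresses it handles) and a polynomial $p$ such that, for every $n$ and every parking function $\alpha$ of length $n$, the program started on the input $(n;a_1,\dots,a_n)$ halts at cost at most $p(n)$ with the output $(n!;N_1(\alpha),\dots,N_n(\alpha))$, so that output entry $j$ divided by $n!$ is $\phi_j(c_\alpha)$ for every $j$. -/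

import Mathlib

namespace ParkingGame

/-! ### Parking processes -/

/-- The first unoccupied spot at or past the preferred spot `a` on a street with spots
`1, …, m`, where `occ` is the set of occupied spots; `none` if there is no such spot. -/
def firstFree (m : ℕ) (occ : Finset ℕ) (a : ℕ) : Option ℕ :=
  (List.range' a (m + 1 - a)).find? (fun p => decide (p ∉ occ))

/-- Cars with the listed preferences arrive one after the other on a street with spots
`1, …, m`, of which those in `occ` are already taken.  The result is the list of the spots in
which the successive cars park, or `none` if some car is unable to park. -/
def park (m : ℕ) : Finset ℕ → List ℕ → Option (List ℕ)
  | _, [] => some []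
  | occ, a :: l =>
    match firstFree m occ a with
    | none => none
    | some p => (park m (insert p occ) l).map (fun ps => p :: ps)

/-- `l` is an `(l.length, m)`-parking function: all preferences lie in `{1, …, m}`, and all the
cars are able to park on an initially empty street with spots `1, …, m`. -/
def IsParking (m : ℕ) (l : List ℕ) : Prop :=
  (∀ a ∈ l, 1 ≤ a ∧ a ≤ m) ∧ (park m ∅ l).isSome = true

instance (m : ℕ) (l : List ℕ) : Decidable (IsParking m l) := by
  unfold IsParking; infer_instance

/-- Total displacement `∑ (pᵢ - aᵢ)` of the cars with preferences `l` on a street with `m`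
spots (only meaningful when `IsParking m l`). -/
def displacement (m : ℕ) (l : List ℕ) : ℕ :=
  match park m ∅ l with
  | none => 0
  | some ps => (List.zipWith (fun p a => p - a) ps l).sum

/-- `α` is a parking function of length `n`; car `i : Fin n` prefers the spot `α i`. -/
def IsParkingFunction {n : ℕ} (α : Fin n → ℕ) : Prop :=
  IsParking n (List.ofFn α)

/-! ### The parking game and the Shapley value -/

/-- The characteristic function of the parking game of `α`: the total displacement of the cars
in `S` (arriving in increasing order of their indices) on the street with `n` spots. -/
def game {n : ℕ} (α : Fin n → ℕ) (S : Finset (Fin n)) : ℕ :=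
  displacement n ((S.sort (· ≤ ·)).map α)

/-- The Shapley value of player `i` in the coalitional game `c` on `n` players. -/
noncomputable def shapley {n : ℕ} (c : Finset (Fin n) → ℝ) (i : Fin n) : ℝ :=
  1 / (n.factorial : ℝ) * ∑ π : Equiv.Perm (Fin n),
    (c (Finset.univ.filter (fun j => π j ≤ π i)) - c (Finset.univ.filter (fun j => π j < π i)))

/-! ### The counting function `Q`, its recursion, and the closed formula -/

/-- The number of size-`k` sub-tuples of `β` (counted by index sets) which, as preference tuples,
make all their cars park in the spots `s, …, t`: after translating `s` to `1`, the sub-tuple is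
a `(k, t - s + 1)`-parking function.  (If `t < s`, there are no spots.) -/
def Q (β : List ℕ) (s t k : ℕ) : ℕ :=
  (β.sublistsLen k).countP
    (fun γ => decide ((∀ b ∈ γ, s ≤ b) ∧ IsParking (t + 1 - s) (γ.map (fun b => b + 1 - s))))

/-- The tuple in which all entries equal to the minimum are increased by one. -/
def U (β : List ℕ) : List ℕ :=
  β.map (fun b => max b (1 + β.min?.getD 0))

/-- The right-hand side of the recursion for `Q β s t k`, for a weakly increasing tuple `β`
(whose first entry is `β.headD 0`). -/
def QStep (β : List ℕ) (s t k : ℕ) : ℕ :=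
  if k = 0 then 1
  else if t + 1 < s + k ∨ β.length < k then 0
  else if β.headD 0 < s then Q β.tail s t k
  else if s < β.headD 0 then Q β (s + 1) t k
  else Q (U β).tail (s + 1) t (k - 1) + Q β.tail s t k

/-- The number of entries of `β` that are at least `t + 2`. -/
def Lam (t : ℕ) (β : List ℕ) : ℕ := β.countP (fun b => decide (t + 2 ≤ b))

/-- The number of entries of `β` that are at most `s - 2`. -/
def Gam (s : ℕ) (β : List ℕ) : ℕ := β.countP (fun b => decide (b + 2 ≤ s))

/-- The factor `R(β, s, t)` of the closed formula for a game with `n` cars. -/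
def R (n : ℕ) (β : List ℕ) (s t : ℕ) : ℕ :=
  ∑ l ∈ Finset.range (Lam t β + 1), ∑ g ∈ Finset.range (Gam s β + 1),
    (Lam t β).choose l * Q β 1 (s - 2) g *
      (t - s + 1 + l + g).factorial * (n + s - (t + l + g + 2)).factorial

/-- The weakly increasing rearrangement `α'` of `α`. -/
def rearr {n : ℕ} (α : Fin n → ℕ) : Fin n → ℕ := α ∘ Tuple.sort α

/-- A rank function: car `j` of `α` is car `rank α j` of the rearrangement `α'`. -/
def rank {n : ℕ} (α : Fin n → ℕ) (j : Fin n) : Fin n := (Tuple.sort α)⁻¹ j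

/-- The closed formula, without the prefactor `1 / n!`, for car `j`: with `i` the rank of `j`,
`∑ₛ ∑ₜ (t - a'ᵢ + 1) Q(α' without entry i, s, t, t - s + 1) R(α' without entry i, s, t)`,
where `1 ≤ s ≤ a'ᵢ ≤ t ≤ n - 1`. -/
def numer {n : ℕ} (α : Fin n → ℕ) (j : Fin n) : ℕ :=
  ∑ s ∈ Finset.Icc 1 (rearr α (rank α j)), ∑ t ∈ Finset.Icc (rearr α (rank α j)) (n - 1),
    (t - rearr α (rank α j) + 1) *
      Q ((List.ofFn (rearr α)).eraseIdx (rank α j)) s t (t - s + 1) *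
      R n ((List.ofFn (rearr α)).eraseIdx (rank α j)) s t

/-! ### Random access machines with logarithmic cost

The memory consists of unbounded banks of cells, each cell holding a natural number.  The bank of
a memory access is fixed in the program text (so that a program uses finitely many banks), the
address inside the bank is computed at run time.  Every operation is charged the bit lengths of
the numbers that it handles, addresses included. -/

/-- A memory: `σ b i` is the content of cell `i` of bank `b`. -/
abbrev Mem : Type := ℕ → ℕ → ℕ

/-- Arithmetic expressions; `load b e` is the content of the cell of bank `b` whose address is
the value of `e`, `sub` is truncated subtraction, `div` is integer division. -/
inductive Expr : Type
  | const (k : ℕ)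
  | load (b : ℕ) (e : Expr)
  | add (e f : Expr)
  | sub (e f : Expr)
  | mul (e f : Expr)
  | div (e f : Expr)

/-- The value of an expression. -/
def Expr.eval (σ : Mem) : Expr → ℕ
  | .const k => k
  | .load b e => σ b (e.eval σ)
  | .add e f => e.eval σ + f.eval σ
  | .sub e f => e.eval σ - f.eval σ
  | .mul e f => e.eval σ * f.eval σ
  | .div e f => e.eval σ / f.eval σ

/-- The cost of evaluating an expression: for each of its nodes, one plus the bit length of the
value at this node (`Nat.size` is the bit length). -/
def Expr.cost (σ : Mem) : Expr → ℕ
  | .const k => 1 + k.size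
  | .load b e => e.cost σ + (1 + (σ b (e.eval σ)).size)
  | .add e f => e.cost σ + f.cost σ + (1 + (e.eval σ + f.eval σ).size)
  | .sub e f => e.cost σ + f.cost σ + (1 + (e.eval σ - f.eval σ).size)
  | .mul e f => e.cost σ + f.cost σ + (1 + (e.eval σ * f.eval σ).size)
  | .div e f => e.cost σ + f.cost σ + (1 + (e.eval σ / f.eval σ).size)

/-- Programs.  `store b e f` writes the value of `f` into the cell of bank `b` whose address is
the value of `e`; tests succeed on nonzero values. -/
inductive Prog : Type
  | skip
  | store (b : ℕ) (e f : Expr)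
  | seq (p q : Prog)
  | ite (e : Expr) (p q : Prog)
  | loop (e : Expr) (p : Prog)

/-- The memory `σ` with the content of cell `i` of bank `b` replaced by `v`. -/
def Mem.write (σ : Mem) (b i v : ℕ) : Mem :=
  fun b' i' => if b' = b ∧ i' = i then v else σ b' i'

/-- `Run p σ τ T`: started on the memory `σ`, the program `p` halts with the memory `τ` at
total cost `T`.  Here `loop e p` is "while `e` is nonzero do `p`". -/
inductive Run : Prog → Mem → Mem → ℕ → Prop
  | skip (σ : Mem) : Run .skip σ σ 1
  | store (σ : Mem) (b : ℕ) (e f : Expr) :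
      Run (.store b e f) σ (σ.write b (e.eval σ) (f.eval σ)) (e.cost σ + f.cost σ + 1)
  | seq {p q : Prog} {σ τ υ : Mem} {T T' : ℕ} (hp : Run p σ τ T) (hq : Run q τ υ T') :
      Run (.seq p q) σ υ (T + T')
  | ite_true {e : Expr} {p q : Prog} {σ τ : Mem} {T : ℕ} (he : e.eval σ ≠ 0)
      (hp : Run p σ τ T) : Run (.ite e p q) σ τ (e.cost σ + 1 + T)
  | ite_false {e : Expr} {p q : Prog} {σ τ : Mem} {T : ℕ} (he : e.eval σ = 0)
      (hq : Run q σ τ T) : Run (.ite e p q) σ τ (e.cost σ + 1 + T)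
  | loop_stop {e : Expr} {p : Prog} {σ : Mem} (he : e.eval σ = 0) :
      Run (.loop e p) σ σ (e.cost σ + 1)
  | loop_step {e : Expr} {p : Prog} {σ τ υ : Mem} {T T' : ℕ} (he : e.eval σ ≠ 0)
      (hp : Run p σ τ T) (hl : Run (.loop e p) τ υ T') :
      Run (.loop e p) σ υ (e.cost σ + 1 + T + T')

/-- The initial memory for the input `α`: in bank `0`, cell `0` holds `n` and the cells
`1, …, n` hold the entries of `α`; all other cells are zero. -/
def input {n : ℕ} (α : Fin n → ℕ) : Mem := fun b i =>
  if b = 0 then (if i = 0 then n else (List.ofFn α).getD (i - 1) 0) else 0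

end ParkingGame

/-! ### Occupied spots, described by counting preferences -/

namespace ParkingGame

/-! On an endless street, spot `p` ends up occupied exactly when, for some `s ≤ p`, at least as many
cars prefer a spot in `[s, p]` as this interval has spots (`Occ`). Such conditions only count
preferences, so the order of arrival is irrelevant. The street `1, …, m` suffices iff no final
segment is overloaded (`Cap`). `park_spec` ties this to the actual process, and the displacement
becomes the sum of the occupied spots minus the sum of the preferences.

Hence a further car with preference `a` contributes `p₀ - a`, where `p₀` is the first free spot from
`a` on. If this is positive, `a` lies in a unique maximal occupied block `s, …, t`, where `t + 1 =
p₀`, and the contribution is `t - a + 1` (`sum_isBlock`). A coalition has this block iff nobody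
prefers `s - 1` or `t + 1`, exactly `t - s + 1` cars prefer spots of the block and all park inside
it, and the cars further left park in `1, …, s - 2`; cars preferring `t + 2` or more are
unrestricted (`isBlock_iff`). A coalition `S` has Shapley weight `|S|! (n - 1 - |S|)!`, so counting
the three independent parts by size yields the closed formula (`sum_isBlock_weight`,
`shapley_game`).

The recursion for `Q` splits on whether the minimal first entry `b` is selected: it can join `k`
later entries that park iff `s ≤ b` and `b + k ≤ t` (`Q_cons_succ`).

For polynomial time, the numbers `Q β s t k` for all `k` are stored as the digits of a single number
in base `B`. A new minimal entry `b` adds a copy truncated modulo `B ^ (t - b + 1)` and shifted by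
one digit (`enc_eq_sum`). Thus nested loops of polynomial length on numbers with polynomially many
bits suffice. `Ctx.Comp` is a class of polynomial-time functions closed under arithmetic, iteration
and sums, in which the formula is assembled. -/

/-- The number of entries of `l` in the half-open interval `[s, q)`. -/
def cnt (l : List ℕ) (s q : ℕ) : ℕ := l.countP (fun a => decide (s ≤ a ∧ a < q))

theorem cnt_cons (a : ℕ) (l : List ℕ) (s q : ℕ) :
    cnt (a :: l) s q = cnt l s q + if s ≤ a ∧ a < q then 1 else 0 := by
  simp [cnt, List.countP_cons]

theorem cnt_split (l : List ℕ) {s p q : ℕ} (h : s ≤ p) (h' : p ≤ q) :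
    cnt l s p + cnt l p q = cnt l s q := by
  induction l with
  | nil => rfl
  | cons a l ih =>
    rw [cnt_cons, cnt_cons, cnt_cons, ← ih]
    split_ifs <;> omega

theorem cnt_perm {l l' : List ℕ} (h : l.Perm l') (s q : ℕ) : cnt l s q = cnt l' s q :=
  h.countP_eq _

theorem cnt_le_length (l : List ℕ) (s q : ℕ) : cnt l s q ≤ l.length := List.countP_le_length

/-- Spot `p` is occupied after cars with preferences `l` have parked on an endless street. -/
def Occ (l : List ℕ) (p : ℕ) : Prop := ∃ s, 1 ≤ s ∧ s ≤ p ∧ p + 1 ≤ s + cnt l s (p + 1)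

theorem not_occ {l : List ℕ} {p : ℕ} :
    ¬ Occ l p ↔ ∀ s, 1 ≤ s → s ≤ p → s + cnt l s (p + 1) ≤ p := by
  simp only [Occ, not_exists, not_and, not_le, Nat.lt_succ_iff]

theorem occ_perm {l l' : List ℕ} (h : l.Perm l') (p : ℕ) : Occ l p ↔ Occ l' p := by
  simp only [Occ, cnt_perm h]

/-- Enough cars prefer a spot in a block of occupied spots, possibly extended to the left. -/
theorem exists_le_cnt_of_occ {l : List ℕ} {a : ℕ} (ha : 1 ≤ a) (q : ℕ) (haq : a ≤ q)
    (h : ∀ x, a ≤ x → x < q → Occ l x) : ∃ s, 1 ≤ s ∧ s ≤ a ∧ q ≤ s + cnt l s q := by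
  induction q using Nat.strong_induction_on with
  | _ q ih =>
    obtain rfl | hlt := haq.eq_or_lt
    · exact ⟨a, ha, le_rfl, by omega⟩
    · obtain ⟨s, hs1, hs, hc⟩ := h (q - 1) (by omega) (by omega)
      have hq : q - 1 + 1 = q := by omega
      rw [hq] at hc
      by_cases hsa : s ≤ a
      · exact ⟨s, hs1, hsa, hc⟩
      -- The witness `s` for the last spot lies inside the block: induction treats `[a, s)`, and the
      -- two counts add up.
      · obtain ⟨s', hs1', hs', hc'⟩ := ih s (by omega) (by omega)
          (fun x h1 h2 => h x h1 (by omega))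
        have := cnt_split l (s := s') (p := s) (q := q) (by omega) (by omega)
        exact ⟨s', hs1', hs', by omega⟩

/-- A further car occupies the first free spot at or past its preferred spot. -/
theorem occ_cons {l : List ℕ} {a p₀ : ℕ} (ha : 1 ≤ a) (hap : a ≤ p₀)
    (h : ∀ x, a ≤ x → x < p₀ → Occ l x) (hp₀ : ¬ Occ l p₀) (p : ℕ) :
    Occ (a :: l) p ↔ p = p₀ ∨ Occ l p := by
  constructor
  · rintro ⟨s, hs1, hs, hc⟩
    by_contra hcon
    push Not at hcon
    obtain ⟨hne, hno⟩ := hcon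
    have h1 := not_occ.1 hno s hs1 hs
    rw [cnt_cons] at hc
    split_ifs at hc with hif
    -- The free spots `p₀` and `p` bound the counts on `[s, p₀]` and `[p₀ + 1, p]` by one less than
    -- and exactly `p - p₀ - 1` spots' worth below; even with the new car, at most `p - s` cars
    -- prefer `[s, p]`.
    · have hlt : p₀ < p := by
        by_contra hcon
        exact hno (h p (by omega) (by omega))
      have h2 := not_occ.1 hno (p₀ + 1) (by omega) (by omega)
      have h3 := not_occ.1 hp₀ s hs1 (by omega)
      have := cnt_split l (s := s) (p := p₀ + 1) (q := p + 1) (by omega) (by omega)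
      omega
    · omega
  · rintro (rfl | ⟨s, hs1, hs, hc⟩)
    · obtain ⟨s, hs1, hs, hc⟩ := exists_le_cnt_of_occ ha p hap h
      have := cnt_split l (s := s) (p := p) (q := p + 1) (by omega) (by omega)
      refine ⟨s, hs1, by omega, ?_⟩
      rw [cnt_cons, if_pos (by omega)]
      omega
    · refine ⟨s, hs1, hs, ?_⟩
      rw [cnt_cons]
      omega

theorem firstFree_eq_some {m : ℕ} {occ : Finset ℕ} {a p : ℕ} (h : firstFree m occ a = some p) :
    a ≤ p ∧ p ≤ m ∧ p ∉ occ ∧ ∀ x, a ≤ x → x < p → x ∈ occ := by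
  simp only [firstFree, List.find?_range'_eq_some] at h
  obtain ⟨h1, h2, h3⟩ := h
  rw [List.mem_range'_1] at h2
  refine ⟨by omega, by omega, by simpa using h1, fun x hx hxp => by simpa using h3 x hx hxp⟩

theorem firstFree_eq_none {m : ℕ} {occ : Finset ℕ} {a : ℕ} (h : firstFree m occ a = none) :
    ∀ x, a ≤ x → x ≤ m → x ∈ occ := by
  simp only [firstFree, List.find?_eq_none, List.mem_range'_1] at h
  intro x hx hxm
  simpa using h x ⟨hx, by omega⟩

/-- No final segment of the street `1, …, m` is preferred by more cars than it has spots. -/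
def Cap (m : ℕ) (l : List ℕ) : Prop :=
  ∀ s, 1 ≤ s → s ≤ m + 1 → s + cnt l s (m + 1) ≤ m + 1

theorem cap_perm {m : ℕ} {l l' : List ℕ} (h : l.Perm l') : Cap m l ↔ Cap m l' := by
  simp only [Cap, cnt_perm h]

/-- Induction on the arriving cars, with `l₀` the preferences of those already parked. The
displacement identity is additive in order to avoid truncated subtraction. -/
theorem park_spec (m : ℕ) (l l₀ : List ℕ) (occ : Finset ℕ) (hocc : ∀ p, p ∈ occ ↔ Occ l₀ p)
    (hsub : occ ⊆ Finset.Icc 1 m) (hl : ∀ a ∈ l, 1 ≤ a ∧ a ≤ m) :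
    (Cap m (l ++ l₀) → ∃ ps, park m occ l = some ps ∧
      (List.zipWith (fun p a => p - a) ps l).sum + l.sum = ps.sum ∧
      ∃ occ' : Finset ℕ, occ' ⊆ Finset.Icc 1 m ∧ (∀ p, p ∈ occ' ↔ Occ (l ++ l₀) p) ∧
        ∑ p ∈ occ', p = ∑ p ∈ occ, p + ps.sum) ∧
    (¬ Cap m (l ++ l₀) → park m occ l = none) := by
  induction l generalizing l₀ occ with
  | nil =>
    refine ⟨fun _ => ⟨[], rfl, rfl, occ, hsub, hocc, rfl⟩, fun hcap => absurd ?_ hcap⟩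
    intro s hs hsm
    -- All cars fit on the street, so spot `m + 1` of the endless street is free, which implies
    -- `Cap`.
    have h : m + 1 ∉ occ := fun h => by simpa using hsub h
    have h1 := not_occ.1 ((hocc _).not.1 h) s hs hsm
    have := cnt_split l₀ hsm (show m + 1 ≤ m + 1 + 1 by omega)
    simp only [List.nil_append]
    omega
  | cons a l ih =>
    obtain ⟨ha1, ham⟩ := hl a (by simp)
    have hperm : (l ++ a :: l₀).Perm (a :: l ++ l₀) := by simp
    cases hf : firstFree m occ a with
    | none =>
      have hpark : park m occ (a :: l) = none := by simp [park, hf]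
      have hcap : ¬ Cap m (a :: l ++ l₀) := by
        intro hcap
        -- The spots `a, …, m` are all taken, so some segment `[s, m]` with `s ≤ a` is already
        -- saturated, and the new car overloads it.
        obtain ⟨s, hs1, hs, hc⟩ := exists_le_cnt_of_occ (l := l₀) ha1 (m + 1) (by omega)
          (fun x h1 h2 => (hocc x).1 (firstFree_eq_none hf x h1 (by omega)))
        have h2 := hcap s hs1 (by omega)
        have h3 : cnt l₀ s (m + 1) ≤ cnt (l ++ l₀) s (m + 1) := by simp [cnt]
        rw [List.cons_append, cnt_cons, if_pos (by omega)] at h2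
        omega
      exact ⟨fun h => absurd h hcap, fun _ => hpark⟩
    | some p =>
      obtain ⟨hap, hpm, hp, hblock⟩ := firstFree_eq_some hf
      have hocc' : ∀ x, x ∈ insert p occ ↔ Occ (a :: l₀) x := fun x => by
        rw [occ_cons ha1 hap (fun x h1 h2 => (hocc x).1 (hblock x h1 h2)) ((hocc p).not.1 hp),
          Finset.mem_insert, hocc]
      have hsub' : insert p occ ⊆ Finset.Icc 1 m :=
        Finset.insert_subset (Finset.mem_Icc.2 ⟨by omega, hpm⟩) hsub
      obtain ⟨h1, h2⟩ := ih (a :: l₀) (insert p occ) hocc' hsub'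
        (fun b hb => hl b (List.mem_cons_of_mem _ hb))
      rw [cap_perm hperm] at h1 h2
      refine ⟨fun hcap => ?_, fun hcap => by simp [park, hf, h2 hcap]⟩
      obtain ⟨ps, hps, hz, occ', hs', ho', hsum⟩ := h1 hcap
      refine ⟨p :: ps, by simp [park, hf, hps], ?_, occ', hs', fun x => ?_, ?_⟩
      · simp only [List.zipWith_cons_cons, List.sum_cons]
        omega
      · rw [ho', occ_perm hperm]
      · rw [hsum, Finset.sum_insert hp, List.sum_cons]
        omega

theorem not_occ_nil (p : ℕ) : ¬ Occ [] p := by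
  rw [not_occ]
  intro s _ h
  simpa [cnt] using h

theorem isParking_iff (m : ℕ) (l : List ℕ) :
    IsParking m l ↔ (∀ a ∈ l, 1 ≤ a ∧ a ≤ m) ∧ Cap m l := by
  rw [IsParking]
  refine and_congr_right fun hl => ?_
  obtain ⟨h1, h2⟩ := park_spec m l [] ∅ (fun p => by simp [not_occ_nil]) (by simp) hl
  rw [List.append_nil] at h1 h2
  by_cases hcap : Cap m l
  · obtain ⟨ps, hps, -⟩ := h1 hcap
    simp [hcap, hps]
  · simp [hcap, h2 hcap]

open Classical in
/-- The set of spots occupied by the cars with preferences `l`. -/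
noncomputable def spots (m : ℕ) (l : List ℕ) : Finset ℕ := (Finset.Icc 1 m).filter (Occ l)

/-- The right-hand side and `l.sum` depend only on the multiset of preferences, hence so does the
displacement. -/
theorem displacement_add_sum {m : ℕ} {l : List ℕ} (hl : IsParking m l) :
    displacement m l + l.sum = ∑ p ∈ spots m l, p := by
  rw [isParking_iff] at hl
  obtain ⟨h1, -⟩ := park_spec m l [] ∅ (fun p => by simp [not_occ_nil]) (by simp) hl.1
  rw [List.append_nil] at h1
  obtain ⟨ps, hps, hz, occ', hsub, hocc, hsum⟩ := h1 hl.2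
  have : spots m l = occ' := by
    ext p
    simp only [spots, Finset.mem_filter, hocc, and_iff_right_iff_imp]
    exact fun h => hsub ((hocc p).2 h)
  rw [this, hsum, displacement, hps]
  simpa using hz

/-! ### The recursion for `Q` -/

/-- The parking criterion for a list whose first entry is minimal. -/
theorem isParking_cons {m b : ℕ} {l : List ℕ} (hb : ∀ a ∈ l, b ≤ a) :
    IsParking m (b :: l) ↔ 1 ≤ b ∧ b + l.length ≤ m ∧ IsParking m l := by
  simp only [isParking_iff, List.forall_mem_cons]
  constructor
  · rintro ⟨⟨hb', hl⟩, hcap⟩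
    refine ⟨hb'.1, ?_, hl, fun s h1 h2 => ?_⟩
    · have h := hcap b hb'.1 (by omega)
      have hc : cnt l b (m + 1) = l.length := by
        rw [cnt, List.countP_eq_length]
        intro a ha
        have := hl a ha
        have := hb a ha
        simp
        omega
      rw [cnt_cons, hc, if_pos (by omega)] at h
      omega
    · have h := hcap s h1 h2
      rw [cnt_cons] at h
      omega
  · rintro ⟨h1, h2, hl, hcap⟩
    refine ⟨⟨⟨h1, by omega⟩, hl⟩, fun s hs1 hs2 => ?_⟩
    have h := hcap s hs1 hs2
    -- Segments starting beyond `b` do not see the new car; for the others the total number of cars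
    -- is small enough.
    have hc := cnt_le_length l s (m + 1)
    rw [cnt_cons]
    split_ifs <;> omega

/-- The cars with preferences `γ` all park in the spots `s, …, t`. -/
def ParksIn (s t : ℕ) (γ : List ℕ) : Prop :=
  (∀ b ∈ γ, s ≤ b) ∧ IsParking (t + 1 - s) (γ.map (fun b => b + 1 - s))

instance (s t : ℕ) (γ : List ℕ) : Decidable (ParksIn s t γ) := by
  unfold ParksIn; infer_instance

theorem parksIn_nil (s t : ℕ) : ParksIn s t [] := by
  refine ⟨by simp, by simp, rfl⟩

theorem parksIn_cons {s t b : ℕ} {γ : List ℕ} (hb : ∀ a ∈ γ, b ≤ a) :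
    ParksIn s t (b :: γ) ↔ (s ≤ b ∧ b + γ.length ≤ t) ∧ ParksIn s t γ := by
  rw [ParksIn, List.map_cons, isParking_cons, List.length_map, ParksIn, List.forall_mem_cons]
  · constructor
    · rintro ⟨⟨h1, h2⟩, h3, h4, h5⟩
      exact ⟨⟨h1, by omega⟩, h2, h5⟩
    · rintro ⟨⟨h1, h2⟩, h3, h4⟩
      exact ⟨⟨h1, h3⟩, by omega, by omega, h4⟩
  · intro a ha
    obtain ⟨c, hc, rfl⟩ := List.mem_map.1 ha
    have := hb c hc
    omega

theorem Q_eq (β : List ℕ) (s t k : ℕ) :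
    Q β s t k = (β.sublistsLen k).countP (fun γ => decide (ParksIn s t γ)) := rfl

theorem Q_zero (β : List ℕ) (s t : ℕ) : Q β s t 0 = 1 := by
  simp [Q_eq, parksIn_nil]

theorem Q_nil_succ (s t k : ℕ) : Q [] s t (k + 1) = 0 := by
  simp [Q_eq]

/-- The sub-tuples are split by whether they use the first entry. As `b` is minimal, `parksIn_cons`
turns its presence into a condition on `b` and `k` alone. All later facts about `Q` come from this
recursion. -/
theorem Q_cons_succ {b : ℕ} {l : List ℕ} (hb : ∀ a ∈ l, b ≤ a) (s t k : ℕ) :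
    Q (b :: l) s t (k + 1) = Q l s t (k + 1) + if s ≤ b ∧ b + k ≤ t then Q l s t k else 0 := by
  rw [Q_eq, List.sublistsLen_succ_cons, List.countP_append, List.countP_map, ← Q_eq]
  congr 1
  have key : ∀ γ ∈ l.sublistsLen k,
      ParksIn s t (b :: γ) ↔ (s ≤ b ∧ b + k ≤ t) ∧ ParksIn s t γ := by
    intro γ hγ
    obtain ⟨hsub, hlen⟩ := List.mem_sublistsLen.1 hγ
    rw [parksIn_cons (fun a ha => hb a (hsub.subset ha)), hlen]
  split_ifs with h
  · rw [Q_eq]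
    refine List.countP_congr fun γ hγ => ?_
    simp [key γ hγ, h]
  · rw [List.countP_eq_zero]
    intro γ hγ
    simp only [Function.comp_apply, decide_eq_true_eq, key γ hγ]
    exact fun h' => h h'.1

theorem Q_eq_zero_of_length_lt {β : List ℕ} {s t k : ℕ} (h : β.length < k) : Q β s t k = 0 := by
  simp [Q_eq, List.sublistsLen_of_length_lt h]

theorem Q_eq_zero_of_lt {β : List ℕ} (hβ : β.Pairwise (· ≤ ·)) {s t k : ℕ} (hk : k ≠ 0)
    (h : t + 1 < s + k) : Q β s t k = 0 := by
  obtain ⟨k, rfl⟩ := Nat.exists_eq_succ_of_ne_zero hk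
  induction β with
  | nil => exact Q_nil_succ s t k
  | cons b l ih =>
    rw [List.pairwise_cons] at hβ
    rw [Q_cons_succ hβ.1, ih hβ.2, if_neg (by omega)]

theorem Q_succ_start {β : List ℕ} (hβ : β.Pairwise (· ≤ ·)) {s t k : ℕ}
    (h : ∀ b ∈ β, s < b) : Q β s t k = Q β (s + 1) t k := by
  induction β generalizing k with
  | nil => cases k <;> simp [Q_zero, Q_nil_succ]
  | cons b l ih =>
    rw [List.pairwise_cons] at hβ
    rw [List.forall_mem_cons] at h
    cases k with
    | zero => simp [Q_zero]
    | succ k =>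
      rw [Q_cons_succ hβ.1, Q_cons_succ hβ.1, ih hβ.2 h.2, ih hβ.2 h.2]
      congr 1
      exact if_congr (by omega) rfl rfl

/-- By `hk` there is room for every selection of `k` entries even when all start past `s`, so moving
entries from `s` to `s + 1` changes no condition in `Q_cons_succ`. -/
theorem Q_map_max {l : List ℕ} (hl : l.Pairwise (· ≤ ·)) {s t k : ℕ} (h : ∀ b ∈ l, s ≤ b)
    (hk : s + k ≤ t) : Q (l.map (fun b => max b (1 + s))) (s + 1) t k = Q l s t k := by
  induction l generalizing k with
  | nil => cases k <;> simp [Q_zero, Q_nil_succ]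
  | cons b l ih =>
    rw [List.pairwise_cons] at hl
    rw [List.forall_mem_cons] at h
    cases k with
    | zero => simp [Q_zero]
    | succ k =>
      rw [List.map_cons, Q_cons_succ hl.1, Q_cons_succ, ih hl.2 h.2 hk, ih hl.2 h.2 (by omega)]
      · congr 1
        exact if_congr (by omega) rfl rfl
      · intro a ha
        obtain ⟨c, hc, rfl⟩ := List.mem_map.1 ha
        have := hl.1 c hc
        omega

theorem Q_eq_QStep {β : List ℕ} (hβ : β.Pairwise (· ≤ ·)) (s t k : ℕ) :
    Q β s t k = QStep β s t k := by
  rw [QStep]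
  split_ifs with h0 h1 h2 h3
  · rw [h0, Q_zero]
  · rcases h1 with h1 | h1
    · exact Q_eq_zero_of_lt hβ h0 h1
    · exact Q_eq_zero_of_length_lt h1
  all_goals
    obtain ⟨k, rfl⟩ := Nat.exists_eq_succ_of_ne_zero h0
    cases β with
    | nil => simp at h1
    | cons b l => ?_
    have hb := (List.pairwise_cons.1 hβ).1
    have hl := (List.pairwise_cons.1 hβ).2
    simp only [List.headD_cons, List.tail_cons] at *
  · rw [Q_cons_succ hb, if_neg (by omega), add_zero]
  · exact Q_succ_start hβ (List.forall_mem_cons.2 ⟨h3, fun a ha => h3.trans_le (hb a ha)⟩)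
  -- If the first car is selected, it only requires `s + k ≤ t`, which the failure of `h1` provides;
  -- this is also the room that `Q_map_max` needs.
  · obtain rfl : b = s := by omega
    have hmin : (b :: l).min? = some b := by
      rw [List.min?_eq_some_iff]
      exact ⟨by simp, List.forall_mem_cons.2 ⟨le_rfl, hb⟩⟩
    rw [Q_cons_succ hb, if_pos (by omega), add_comm, U, hmin, List.map_cons, List.tail_cons,
      Option.getD_some, Nat.succ_sub_one, Q_map_max hl hb (by omega)]

/-! ### The Shapley value as a weighted sum over coalitions -/

section Orders

open Finset

variable {n : ℕ}

/-- The orders in which precisely the players in `S` precede player `j`. -/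
def ordersWithPred (S : Finset (Fin n)) (j : Fin n) : Finset (Equiv.Perm (Fin n)) :=
  univ.filter (fun π => univ.filter (fun l => π l < π j) = S)

theorem card_perm_lt (π : Equiv.Perm (Fin n)) (j : Fin n) :
    #(univ.filter (fun l => π l < π j)) = (π j : ℕ) := by
  have : (univ.filter (fun l => π l < π j)).map π.toEmbedding = Finset.Iio (π j) := by
    ext x
    simp only [mem_map_equiv, mem_filter, mem_univ, true_and, mem_Iio, Equiv.apply_symm_apply]
  rw [← Finset.card_map π.toEmbedding, this, Fin.card_Iio]

theorem mem_ordersWithPred {S : Finset (Fin n)} {j : Fin n} {π : Equiv.Perm (Fin n)} :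
    π ∈ ordersWithPred S j ↔ (∀ x, x ∈ S ↔ (π x : ℕ) < #S) ∧ (π j : ℕ) = #S := by
  simp only [ordersWithPred, mem_filter, mem_univ, true_and]
  constructor
  · intro h
    have hc : (π j : ℕ) = #S := by rw [← h, card_perm_lt]
    refine ⟨fun x => ?_, hc⟩
    rw [← hc, ← h]
    simp
  · rintro ⟨h, hc⟩
    ext x
    rw [h, ← hc]
    simp

/-- Exchanging the players `j` and `j'` fixes `S` as a set, since neither belongs to it. -/
theorem card_ordersWithPred_eq (S : Finset (Fin n)) {j j' : Fin n} (hj : j ∉ S) (hj' : j' ∉ S) :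
    #(ordersWithPred S j) = #(ordersWithPred S j') := by
  have hS : ∀ x, Equiv.swap j j' x ∈ S ↔ x ∈ S := by
    intro x
    rcases eq_or_ne x j with rfl | h1
    · simp [hj, hj']
    rcases eq_or_ne x j' with rfl | h2
    · simp [hj, hj']
    rw [Equiv.swap_apply_of_ne_of_ne h1 h2]
  refine card_bij' (fun π _ => π * Equiv.swap j j') (fun π _ => π * Equiv.swap j j') ?_ ?_ ?_ ?_
  · intro π h
    rw [mem_ordersWithPred] at h ⊢
    refine ⟨fun x => ?_, by simpa using h.2⟩
    rw [← hS x, h.1]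
    rfl
  · intro π h
    rw [mem_ordersWithPred] at h ⊢
    refine ⟨fun x => ?_, by simpa using h.2⟩
    rw [← hS x, h.1]
    rfl
  · intro π _
    simp [mul_assoc]
  · intro π _
    simp [mul_assoc]

theorem card_prefix_orders (S : Finset (Fin n)) :
    #(univ.filter (fun π : Equiv.Perm (Fin n) => ∀ x, x ∈ S ↔ (π x : ℕ) < #S)) =
      (#S).factorial * (n - #S).factorial := by
  have h := Numbering.card_prefixed S
  rw [Fintype.card_fin] at h
  rw [← h]
  refine card_equiv (Equiv.equivCongr (Equiv.refl (Fin n)) (finCongr (Fintype.card_fin n).symm))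
    fun π => ?_
  simp [Numbering.IsPrefix]

/-- The orders that begin with `S` are classified by the next player. The `n - #S` classes have
equal size, so the count follows from `card_prefix_orders` by cancelling one factor. -/
theorem card_ordersWithPred (S : Finset (Fin n)) (j : Fin n) (hj : j ∉ S) :
    #(ordersWithPred S j) = (#S).factorial * (n - 1 - #S).factorial := by
  have hlt : #S < n := by
    have := card_lt_univ_of_notMem hj
    rwa [Fintype.card_fin] at this
  have hsum := card_eq_sum_card_fiberwise
    (s := univ.filter (fun π : Equiv.Perm (Fin n) => ∀ x, x ∈ S ↔ (π x : ℕ) < #S))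
    (t := Sᶜ) (f := fun π => π.symm ⟨#S, hlt⟩) (by
      intro π hπ
      simp only [coe_filter, mem_univ, true_and, Set.mem_ofPred_eq] at hπ
      simp [hπ])
  have hfib : ∀ j' ∈ Sᶜ, #{π ∈ univ.filter
      (fun π : Equiv.Perm (Fin n) => ∀ x, x ∈ S ↔ (π x : ℕ) < #S) | π.symm ⟨#S, hlt⟩ = j'} =
      #(ordersWithPred S j) := by
    intro j' hj'
    rw [← card_ordersWithPred_eq S (mem_compl.1 hj') hj]
    congr 1
    ext π
    rw [mem_filter, mem_filter, mem_ordersWithPred, Equiv.symm_apply_eq, Fin.ext_iff]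
    simp only [mem_univ, true_and]
    exact and_congr_right fun _ => eq_comm
  rw [card_prefix_orders, sum_congr rfl hfib, sum_const, card_compl, Fintype.card_fin,
    smul_eq_mul] at hsum
  obtain ⟨d, hd⟩ := Nat.exists_eq_add_of_lt hlt
  have h1 : n - #S = d + 1 := by omega
  have h2 : n - 1 - #S = d := by omega
  rw [h1, Nat.factorial_succ] at hsum
  rw [h2]
  have : (d + 1) * #(ordersWithPred S j) = (d + 1) * ((#S).factorial * d.factorial) := by
    rw [← hsum]; ring
  exact Nat.eq_of_mul_eq_mul_left (Nat.succ_pos d) this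

/-- The Shapley value as a weighted sum of marginal contributions over coalitions. -/
theorem shapley_eq_sum_powerset (c : Finset (Fin n) → ℝ) (j : Fin n) :
    shapley c j = 1 / (n.factorial : ℝ) * ∑ S ∈ (univ.erase j).powerset,
      (((#S).factorial * (n - 1 - #S).factorial : ℕ) : ℝ) * (c (insert j S) - c S) := by
  rw [shapley]
  congr 1
  have hmaps : ∀ π ∈ (univ : Finset (Equiv.Perm (Fin n))),
      univ.filter (fun l => π l < π j) ∈ (univ.erase j).powerset := by
    intro π _
    rw [mem_powerset]
    intro x hx
    simp only [mem_filter, mem_univ, true_and] at hx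
    simp only [mem_erase, mem_univ, and_true]
    rintro rfl
    exact lt_irrefl _ hx
  rw [← sum_fiberwise_of_maps_to hmaps]
  refine sum_congr rfl fun S hS => ?_
  have hj : j ∉ S := fun h => by simpa using mem_powerset.1 hS h
  rw [← card_ordersWithPred S j hj, ← nsmul_eq_mul, ← sum_const]
  refine sum_congr rfl fun π hπ => ?_
  rw [ordersWithPred, mem_filter] at hπ
  rw [hπ.2]
  congr 2
  rw [← hπ.2]
  ext x
  simp only [mem_filter, mem_univ, true_and, mem_insert, le_iff_lt_or_eq,
    EmbeddingLike.apply_eq_iff_eq]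
  exact or_comm

end Orders

/-! ### Marginal contributions and maximal blocks of occupied spots -/

open Finset

section Coalitions

variable {n : ℕ} (α : Fin n → ℕ)

/-- The number of cars in `S` that prefer a spot in the half-open interval `[s, q)`. -/
def carCnt (S : Finset (Fin n)) (s q : ℕ) : ℕ := #(S.filter (fun i => s ≤ α i ∧ α i < q))

/-- Spot `p` is occupied after the cars in `S` have parked. -/
def CarOcc (S : Finset (Fin n)) (p : ℕ) : Prop :=
  ∃ s, 1 ≤ s ∧ s ≤ p ∧ p + 1 ≤ s + carCnt α S s (p + 1)

/-- The cars in `S` all park in the spots `s, …, t`. -/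
def CarsParkIn (s t : ℕ) (S : Finset (Fin n)) : Prop :=
  (∀ i ∈ S, s ≤ α i ∧ α i ≤ t) ∧ ∀ u, s ≤ u → u ≤ t + 1 → u + carCnt α S u (t + 1) ≤ t + 1

variable {α}

/-- Matching lists with sets of cars through multisets keeps different cars with equal preferences
apart. -/
theorem countP_eq_card_filter {l : List ℕ} {S : Finset (Fin n)}
    (h : (l : Multiset ℕ) = S.val.map α) (p : ℕ → Prop) [DecidablePred p] :
    l.countP (fun b => decide (p b)) = #(S.filter (fun i => p (α i))) := by
  rw [← Multiset.coe_countP, h, Multiset.countP_map]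
  rfl

theorem cnt_eq_carCnt {l : List ℕ} {S : Finset (Fin n)} (h : (l : Multiset ℕ) = S.val.map α)
    (s q : ℕ) : cnt l s q = carCnt α S s q := countP_eq_card_filter h _

theorem coe_map_sort (S : Finset (Fin n)) :
    (((S.sort (· ≤ ·)).map α : List ℕ) : Multiset ℕ) = S.val.map α := by
  rw [← Multiset.map_coe, Finset.sort_eq]

theorem occ_map_sort (S : Finset (Fin n)) (p : ℕ) :
    Occ ((S.sort (· ≤ ·)).map α) p ↔ CarOcc α S p := by
  simp only [Occ, CarOcc, cnt_eq_carCnt (coe_map_sort S)]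

theorem coe_ofFn : ((List.ofFn α : List ℕ) : Multiset ℕ) = (univ : Finset (Fin n)).val.map α := by
  rw [List.ofFn_eq_map, ← Multiset.map_coe]
  rfl

theorem IsParkingFunction.mem_Icc (hα : IsParkingFunction α) (i : Fin n) :
    1 ≤ α i ∧ α i ≤ n :=
  hα.1 _ (List.mem_ofFn.2 ⟨i, rfl⟩)

theorem carCnt_mono {S T : Finset (Fin n)} (h : S ⊆ T) (s q : ℕ) :
    carCnt α S s q ≤ carCnt α T s q :=
  card_le_card (filter_subset_filter _ h)

theorem carCnt_split (S : Finset (Fin n)) {s p q : ℕ} (h : s ≤ p) (h' : p ≤ q) :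
    carCnt α S s p + carCnt α S p q = carCnt α S s q := by
  simp only [← cnt_eq_carCnt (coe_map_sort S), cnt_split _ h h']

theorem carCnt_insert {S : Finset (Fin n)} {j : Fin n} (hj : j ∉ S) (s q : ℕ) :
    carCnt α (insert j S) s q = carCnt α S s q + if s ≤ α j ∧ α j < q then 1 else 0 := by
  unfold carCnt
  rw [filter_insert]
  split_ifs with h
  · rw [card_insert_of_notMem (by simp [hj])]
  · rfl

theorem not_carOcc {S : Finset (Fin n)} {p : ℕ} :
    ¬ CarOcc α S p ↔ ∀ s, 1 ≤ s → s ≤ p → s + carCnt α S s (p + 1) ≤ p := by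
  simp only [CarOcc, not_exists, not_and, not_le, Nat.lt_succ_iff]

theorem not_carOcc_zero (S : Finset (Fin n)) : ¬ CarOcc α S 0 := by
  rintro ⟨s, h1, h2, -⟩
  omega

theorem exists_le_carCnt {S : Finset (Fin n)} {a : ℕ} (ha : 1 ≤ a) (q : ℕ) (haq : a ≤ q)
    (h : ∀ x, a ≤ x → x < q → CarOcc α S x) :
    ∃ s, 1 ≤ s ∧ s ≤ a ∧ q ≤ s + carCnt α S s q := by
  simp only [← occ_map_sort, ← cnt_eq_carCnt (coe_map_sort S)] at h ⊢
  exact exists_le_cnt_of_occ ha q haq h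

theorem IsParkingFunction.cap (hα : IsParkingFunction α) (S : Finset (Fin n)) {s : ℕ}
    (hs : 1 ≤ s) (hsn : s ≤ n + 1) : s + carCnt α S s (n + 1) ≤ n + 1 := by
  have h := ((isParking_iff _ _).1 hα).2 s hs hsn
  rw [cnt_eq_carCnt coe_ofFn] at h
  exact (Nat.add_le_add_left (carCnt_mono (subset_univ S) _ _) s).trans h

theorem IsParkingFunction.isParking (hα : IsParkingFunction α) (S : Finset (Fin n)) :
    IsParking n ((S.sort (· ≤ ·)).map α) := by
  rw [isParking_iff]
  constructor
  · intro a ha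
    obtain ⟨i, -, rfl⟩ := List.mem_map.1 ha
    exact hα.mem_Icc i
  · intro s hs hsn
    rw [cnt_eq_carCnt (coe_map_sort S)]
    exact hα.cap S hs hsn

open Classical in
theorem game_add_sum (hα : IsParkingFunction α) (S : Finset (Fin n)) :
    game α S + ∑ i ∈ S, α i = ∑ p ∈ (Icc 1 n).filter (CarOcc α S), p := by
  have h := displacement_add_sum (hα.isParking S)
  have hsum : ((S.sort (· ≤ ·)).map α).sum = ∑ i ∈ S, α i := by
    rw [← Multiset.sum_coe, coe_map_sort]
    rfl
  rw [hsum] at h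
  rw [game, h, spots]
  refine sum_congr (filter_congr fun p _ => occ_map_sort S p) fun _ _ => rfl

/-- The spot in which a car parks if it prefers spot `a` and arrives after the cars in `S`. -/
theorem exists_firstFree (hα : IsParkingFunction α) {S : Finset (Fin n)} {j : Fin n}
    (hj : j ∉ S) : ∃ p, α j ≤ p ∧ p ≤ n ∧ ¬ CarOcc α S p ∧
      ∀ x, α j ≤ x → x < p → CarOcc α S x := by
  classical
  obtain ⟨ha1, han⟩ := hα.mem_Icc j
  have hex : ∃ p, α j ≤ p ∧ p ≤ n ∧ ¬ CarOcc α S p := by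
    by_contra hcon
    push Not at hcon
    -- If all of `α j, …, n` were occupied, adding `j` would overload a final segment.
    obtain ⟨s, hs1, hs, hc⟩ := exists_le_carCnt (S := S) ha1 (n + 1) (by omega)
      (fun x h1 h2 => hcon x h1 (by omega))
    have := hα.cap (insert j S) hs1 (by omega)
    rw [carCnt_insert hj, if_pos (by omega)] at this
    omega
  obtain ⟨h1, h2, h3⟩ := Nat.find_spec hex
  refine ⟨Nat.find hex, h1, h2, h3, fun x hx hlt => ?_⟩
  have := Nat.find_min hex hlt
  push Not at this
  exact this hx (by omega)

theorem carOcc_insert {S : Finset (Fin n)} {j : Fin n} (hj : j ∉ S) {p₀ : ℕ} (ha : 1 ≤ α j)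
    (hap : α j ≤ p₀) (h : ∀ x, α j ≤ x → x < p₀ → CarOcc α S x) (hp₀ : ¬ CarOcc α S p₀) (p : ℕ) :
    CarOcc α (insert j S) p ↔ p = p₀ ∨ CarOcc α S p := by
  simp only [← occ_map_sort] at h hp₀ ⊢
  rw [← occ_cons ha hap h hp₀]
  refine occ_perm ?_ p
  rw [← Multiset.coe_eq_coe, ← Multiset.cons_coe, coe_map_sort, coe_map_sort,
    insert_val_of_notMem hj, Multiset.map_cons]

/-- The occupied set gains exactly `p₀`; the two instances of `game_add_sum` are compared. -/
theorem game_insert (hα : IsParkingFunction α) {S : Finset (Fin n)} {j : Fin n} (hj : j ∉ S)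
    {p₀ : ℕ} (hap : α j ≤ p₀) (hpn : p₀ ≤ n) (h : ∀ x, α j ≤ x → x < p₀ → CarOcc α S x)
    (hp₀ : ¬ CarOcc α S p₀) : game α (insert j S) = game α S + (p₀ - α j) := by
  classical
  have ha := (hα.mem_Icc j).1
  have h1 := game_add_sum hα S
  have h2 := game_add_sum hα (insert j S)
  have hset : (Icc 1 n).filter (CarOcc α (insert j S)) =
      insert p₀ ((Icc 1 n).filter (CarOcc α S)) := by
    ext p
    simp only [mem_filter, mem_insert, mem_Icc, carOcc_insert hj ha hap h hp₀]
    constructor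
    · tauto
    · rintro (rfl | h)
      · exact ⟨by omega, Or.inl rfl⟩
      · tauto
  rw [hset, sum_insert hj, sum_insert (by simp [hp₀])] at h2
  omega

variable (α) in
/-- The spots `s, …, t` form a maximal block of occupied spots after the cars in `S` parked. -/
def IsBlock (S : Finset (Fin n)) (s t : ℕ) : Prop :=
  ¬ CarOcc α S (s - 1) ∧ ¬ CarOcc α S (t + 1) ∧ ∀ x, s ≤ x → x ≤ t → CarOcc α S x

open Classical in
-- At most one pair contributes: `t + 1` must be the first free spot from `a` on, and `s - 1` the
-- last free spot before `a`. If `a` itself is free, there is no such pair and both sides vanish.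
theorem sum_isBlock {S : Finset (Fin n)} {a p₀ : ℕ} (ha : 1 ≤ a) (hap : a ≤ p₀) (hpn : p₀ ≤ n)
    (h : ∀ x, a ≤ x → x < p₀ → CarOcc α S x) (hp₀ : ¬ CarOcc α S p₀) :
    ∑ s ∈ Icc 1 a, ∑ t ∈ Icc a (n - 1), (if IsBlock α S s t then t - a + 1 else 0) = p₀ - a := by
  have hend : ∀ s ∈ Icc 1 a, ∀ t ∈ Icc a (n - 1), IsBlock α S s t → t + 1 = p₀ := by
    intro s hs t ht hb
    rw [mem_Icc] at hs ht
    by_contra hne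
    rcases lt_or_gt_of_ne hne with hlt | hlt
    · exact hb.2.1 (h _ (by omega) hlt)
    · exact hp₀ (hb.2.2 _ (by omega) (by omega))
  obtain rfl | hlt := hap.eq_or_lt
  · rw [Nat.sub_self]
    refine sum_eq_zero fun s hs => sum_eq_zero fun t ht => if_neg fun hb => ?_
    have := hend s hs t ht hb
    rw [mem_Icc] at ht
    omega
  -- Spot `0` is never occupied, so the search to the left for a free spot terminates.
  · have hex : ∃ d, ¬ CarOcc α S (a - d) := ⟨a, by simpa using not_carOcc_zero S⟩
    have hd := Nat.find_spec hex
    have hmin := fun m => Nat.find_min hex (m := m)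
    set d := Nat.find hex with hddef
    have hd0 : d ≠ 0 := fun h0 => by
      rw [h0] at hd
      exact hd (h a le_rfl hlt)
    have hda : d ≤ a := by
      by_contra hcon
      exact hmin a (by omega) (by simpa using not_carOcc_zero S)
    have hblock : IsBlock α S (a - d + 1) (p₀ - 1) := by
      refine ⟨by simpa using hd, by rwa [Nat.sub_add_cancel (by omega)], fun x h1 h2 => ?_⟩
      by_cases hxa : a ≤ x
      · exact h x hxa (by omega)
      · have := hmin (a - x) (by omega)
        rwa [not_not, Nat.sub_sub_self (by omega)] at this
    have huniq : ∀ s ∈ Icc 1 a, ∀ t ∈ Icc a (n - 1), IsBlock α S s t → s = a - d + 1 := by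
      intro s hs t ht hb
      rw [mem_Icc] at hs ht
      by_contra hne
      rcases lt_or_gt_of_ne hne with hlt' | hlt'
      · exact hd (hb.2.2 _ (by omega) (by omega))
      · exact hb.1 (hblock.2.2 _ (by omega) (by omega))
    have hs₀ : a - d + 1 ∈ Icc 1 a := mem_Icc.2 (by omega)
    have ht₀ : p₀ - 1 ∈ Icc a (n - 1) := mem_Icc.2 (by omega)
    rw [sum_eq_single_of_mem _ hs₀, sum_eq_single_of_mem _ ht₀, if_pos hblock]
    · omega
    · intro t ht hne
      refine if_neg fun hb => hne ?_
      have := hend _ hs₀ t ht hb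
      omega
    · intro s hs hne
      exact sum_eq_zero fun t ht => if_neg fun hb => hne (huniq s hs t ht hb)

/-- A maximal block splits the cars into those parking before, in and after it. -/
theorem isBlock_iff (hα : ∀ i, 1 ≤ α i) {S : Finset (Fin n)} {s t : ℕ} (hs : 1 ≤ s) (hst : s ≤ t) :
    IsBlock α S s t ↔ (∀ i ∈ S, α i + 1 ≠ s ∧ α i ≠ t + 1) ∧
      (CarsParkIn α s t (S.filter (fun i => s ≤ α i ∧ α i ≤ t)) ∧
        #(S.filter (fun i => s ≤ α i ∧ α i ≤ t)) = t - s + 1) ∧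
      CarsParkIn α 1 (s - 2) (S.filter (fun i => α i + 2 ≤ s)) := by
  have hA : ∀ u, s ≤ u → carCnt α (S.filter (fun i => s ≤ α i ∧ α i ≤ t)) u (t + 1) =
      carCnt α S u (t + 1) := by
    intro u hu
    unfold carCnt
    rw [filter_filter]
    congr 1
    exact filter_congr fun i _ => by omega
  have hAc : #(S.filter (fun i => s ≤ α i ∧ α i ≤ t)) = carCnt α S s (t + 1) := by
    unfold carCnt
    congr 1
    exact filter_congr fun i _ => by omega
  have hB : ∀ u, 1 ≤ u → 2 ≤ s → carCnt α (S.filter (fun i => α i + 2 ≤ s)) u (s - 2 + 1) =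
      carCnt α S u (s - 1) := by
    intro u hu h2
    unfold carCnt
    rw [filter_filter]
    congr 1
    exact filter_congr fun i _ => by omega
  have hmiss : ∀ v, carCnt α S v (v + 1) = 0 ↔ ∀ i ∈ S, α i ≠ v := by
    intro v
    rw [carCnt, card_eq_zero, filter_eq_empty_iff]
    exact forall₂_congr fun i _ => by omega
  constructor
  · rintro ⟨h1, h2, h3⟩
    rw [not_carOcc] at h1 h2
    have hv2 : carCnt α S (t + 1) (t + 1 + 1) = 0 := by
      have := h2 (t + 1) (by omega) le_rfl
      omega
    have hv1 : 2 ≤ s → carCnt α S (s - 1) (s - 1 + 1) = 0 := by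
      intro h
      have := h1 (s - 1) (by omega) le_rfl
      omega
    refine ⟨fun i hi => ⟨fun h => ?_, fun h => (hmiss _).1 hv2 i hi h⟩,
      ⟨⟨?_, fun u hu hut => ?_⟩, ?_⟩, ?_, ?_⟩
    · have := hα i
      exact (hmiss _).1 (hv1 (by omega)) i hi (by omega)
    · simp
    · rw [hA u hu]
      have h4 := h2 u (by omega) hut
      have := carCnt_split (α := α) S (s := u) (p := t + 1) (q := t + 1 + 1) hut (by omega)
      omega
    · rw [hAc]
      -- Occupancy of the block gives the lower bound on the count, possibly from some `u < s`, but
      -- then the free spot `s - 1` limits the cars from the left. The free spot `t + 1` gives the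
      -- upper bound.
      obtain ⟨u, hu1, hus, hc⟩ := exists_le_carCnt (S := S) hs (t + 1) (by omega)
        (fun x hx hx' => h3 x hx (by omega))
      have h4 := h2 s hs (by omega)
      have h5 := carCnt_split (α := α) S (s := s) (p := t + 1) (q := t + 1 + 1)
        (by omega) (by omega)
      have h6 := carCnt_split (α := α) S (s := u) (p := s) (q := t + 1) hus (by omega)
      obtain rfl | hlt := hus.eq_or_lt
      · omega
      · have h7 := h1 u hu1 (by omega)
        rw [Nat.sub_add_cancel hs] at h7
        omega
    · intro i hi
      have := hα i
      rw [mem_filter] at hi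
      omega
    · intro u hu hus
      -- For `s = 1` the truncated `s - 2` is `0` and `hB` is unavailable, but then no car lies to
      -- the left.
      by_cases h : 2 ≤ s
      · rw [hB u hu h]
        have h7 := h1 u hu (by omega)
        rw [Nat.sub_add_cancel hs] at h7
        have := carCnt_split (α := α) S (s := u) (p := s - 1) (q := s) (by omega) (by omega)
        omega
      · have h0 : S.filter (fun i => α i + 2 ≤ s) = ∅ := by
          rw [filter_eq_empty_iff]
          intro i _
          have := hα i
          omega
        rw [h0]
        simpa [carCnt] using hus
  · rintro ⟨hno, ⟨⟨-, hpark⟩, hcard⟩, -, hpark'⟩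
    rw [hAc] at hcard
    have hv2 : carCnt α S (t + 1) (t + 1 + 1) = 0 := (hmiss _).2 fun i hi => (hno i hi).2
    have hv1 : carCnt α S (s - 1) (s - 1 + 1) = 0 :=
      (hmiss _).2 fun i hi h => (hno i hi).1 (by omega)
    rw [Nat.sub_add_cancel hs] at hv1
    -- The cars to the left fit into `1, …, s - 2` and nobody prefers `s - 1`, so every `[u, s)` has
    -- a spot to spare.
    have hleft : ∀ u, 1 ≤ u → u + 1 ≤ s → u + carCnt α S u s + 1 ≤ s := by
      intro u hu hus
      have := carCnt_split (α := α) S (s := u) (p := s - 1) (q := s) (by omega) (by omega)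
      have h := hpark' u hu (by omega)
      rw [hB u hu (by omega)] at h
      omega
    refine ⟨?_, ?_, fun x hx hxt => ⟨s, hs, hx, ?_⟩⟩
    · rw [not_carOcc]
      intro u hu hus
      have := hleft u hu (by omega)
      rw [Nat.sub_add_cancel hs]
      omega
    · rw [not_carOcc]
      intro u hu hut
      have h1 := carCnt_split (α := α) S (s := u) (p := t + 1) (q := t + 1 + 1) hut (by omega)
      by_cases hus : s ≤ u
      · have := hpark u hus hut
        rw [hA u hus] at this
        omega
      · have h2 := carCnt_split (α := α) S (s := u) (p := s) (q := t + 1) (by omega) (by omega)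
        have := hleft u hu (by omega)
        omega
    -- At most `t - x` of the `t - s + 1` cars of the block prefer a spot after `x`, so enough
    -- remain for `[s, x]`.
    · have h1 := carCnt_split (α := α) S (s := s) (p := x + 1) (q := t + 1) (by omega) (by omega)
      have := hpark (x + 1) (by omega) (by omega)
      rw [hA _ (by omega)] at this
      omega

end Coalitions

/-! ### Counting coalitions with `Q`, and the closed formula -/

theorem parksIn_iff (s t : ℕ) (γ : List ℕ) : ParksIn s t γ ↔ (∀ b ∈ γ, s ≤ b ∧ b ≤ t) ∧
    ∀ u, s ≤ u → u ≤ t + 1 → u + cnt γ u (t + 1) ≤ t + 1 := by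
  rw [ParksIn, isParking_iff, ← and_assoc]
  have hmem : ((∀ b ∈ γ, s ≤ b) ∧
      ∀ a ∈ γ.map (fun b => b + 1 - s), 1 ≤ a ∧ a ≤ t + 1 - s) ↔ ∀ b ∈ γ, s ≤ b ∧ b ≤ t := by
    simp only [List.forall_mem_map]
    constructor
    · rintro ⟨h1, h2⟩ b hb
      have := h1 b hb
      have := h2 b hb
      omega
    · intro h
      refine ⟨fun b hb => (h b hb).1, fun b hb => ?_⟩
      have := h b hb
      omega
  rw [hmem]
  refine and_congr_right fun h => ?_
  have hcnt : ∀ v, 1 ≤ v → s ≤ t + 1 →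
      cnt (γ.map (fun b => b + 1 - s)) v (t + 1 - s + 1) = cnt γ (v + s - 1) (t + 1) := by
    intro v hv hst
    rw [cnt, List.countP_map]
    refine List.countP_congr fun b hb => ?_
    have := h b hb
    simp only [Function.comp_apply, decide_eq_true_eq]
    omega
  constructor
  · intro hcap u hu hut
    have := hcap (u + 1 - s) (by omega) (by omega)
    rw [hcnt _ (by omega) (by omega), show u + 1 - s + s - 1 = u by omega] at this
    omega
  · intro hpark v hv hvt
    by_cases hst : s ≤ t + 1
    · rw [hcnt v hv hst]
      have := hpark (v + s - 1) (by omega) (by omega)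
      omega
    · have : γ = [] := List.eq_nil_iff_forall_not_mem.2 fun b hb => by
        have := h b hb
        omega
      subst this
      simpa [cnt] using hvt

section Coalitions

variable {n : ℕ} {α : Fin n → ℕ}

open Classical in
-- The parking condition is a predicate `P` on multisets, so it can be transported along
-- `Multiset.powersetCard_map` from sub-tuples to coalitions.
theorem Q_eq_card {β : List ℕ} {E : Finset (Fin n)} (h : (β : Multiset ℕ) = E.val.map α)
    (s t k : ℕ) : Q β s t k = #((E.powersetCard k).filter (CarsParkIn α s t)) := by
  let P : Multiset ℕ → Prop := fun m => (∀ b ∈ m, s ≤ b ∧ b ≤ t) ∧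
    ∀ u, s ≤ u → u ≤ t + 1 → u + m.countP (fun a => u ≤ a ∧ a < t + 1) ≤ t + 1
  have hP : ∀ γ : List ℕ, ParksIn s t γ ↔ P (γ : Multiset ℕ) := by
    intro γ
    rw [parksIn_iff]
    rfl
  have h1 : Q β s t k = Multiset.countP P (Multiset.powersetCard k (β : Multiset ℕ)) := by
    rw [Multiset.powersetCard_coe, Multiset.coe_countP, List.countP_map, Q_eq]
    refine List.countP_congr fun γ _ => ?_
    simp only [decide_eq_true_eq, Function.comp_apply, hP]
  rw [h1, h, Multiset.powersetCard_map, Multiset.countP_map, ← Finset.map_val_val_powersetCard,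
    Multiset.filter_map, Multiset.card_map]
  change #((E.powersetCard k).filter _) = _
  congr 1
  refine filter_congr fun S _ => ?_
  simp only [P, CarsParkIn, Function.comp_apply, Multiset.mem_map, mem_val, forall_exists_index,
    and_imp, forall_apply_eq_imp_iff₂, carCnt, Multiset.countP_map]
  rfl

theorem rearr_rank (α : Fin n → ℕ) (j : Fin n) : rearr α (rank α j) = α j := by
  simp [rearr, rank]

theorem pairwise_ofFn_rearr (α : Fin n → ℕ) : (List.ofFn (rearr α)).Pairwise (· ≤ ·) := by
  rw [List.pairwise_ofFn]
  exact fun i j hij => Tuple.monotone_sort α hij.le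

/-- The preferences of the cars other than `j`, in weakly increasing order. -/
def others (α : Fin n → ℕ) (j : Fin n) : List ℕ := (List.ofFn (rearr α)).eraseIdx (rank α j)

theorem pairwise_others (α : Fin n → ℕ) (j : Fin n) : (others α j).Pairwise (· ≤ ·) :=
  (pairwise_ofFn_rearr α).sublist (List.eraseIdx_sublist _ _)

theorem coe_others (α : Fin n → ℕ) (j : Fin n) :
    (others α j : Multiset ℕ) = (univ.erase j).val.map α := by
  have h1 : ((List.ofFn (rearr α) : List ℕ) : Multiset ℕ) = univ.val.map α := by
    rw [coe_ofFn, rearr, ← Multiset.map_map]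
    congr 1
    simp
  have h2 : (α j) ::ₘ (others α j : Multiset ℕ) = (List.ofFn (rearr α) : Multiset ℕ) := by
    rw [others, Multiset.cons_coe, Multiset.coe_eq_coe]
    have hlt : (rank α j : ℕ) < (List.ofFn (rearr α)).length := by simp
    have h := List.getElem_cons_eraseIdx_perm hlt
    simpa [rearr_rank] using h
  have h3 : (univ : Finset (Fin n)).val.map α = α j ::ₘ (univ.erase j).val.map α := by
    rw [← Multiset.map_cons, ← insert_val_of_notMem (notMem_erase j univ),
      insert_erase (mem_univ j)]
  rwa [h1, h3, Multiset.cons_inj_right] at h2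

open Classical in
theorem sum_parkIn_card {E : Finset (Fin n)} {β : List ℕ} (h : (β : Multiset ℕ) = E.val.map α)
    (s t : ℕ) {m : ℕ} (hm : ∀ S ∈ E.powerset, CarsParkIn α s t S → #S ≤ m) (f : ℕ → ℕ) :
    ∑ S ∈ E.powerset.filter (CarsParkIn α s t), f #S = ∑ g ∈ range (m + 1), Q β s t g * f g := by
  have hmaps : ∀ S ∈ E.powerset.filter (CarsParkIn α s t), #S ∈ range (m + 1) := by
    intro S hS
    rw [mem_filter] at hS
    exact mem_range.2 (Nat.lt_succ_of_le (hm S hS.1 hS.2))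
  rw [← sum_fiberwise_of_maps_to hmaps]
  refine sum_congr rfl fun g _ => ?_
  rw [Q_eq_card h, ← smul_eq_mul, ← sum_const]
  refine sum_congr ?_ fun S hS => ?_
  · ext S
    simp only [mem_filter, mem_powerset, mem_powersetCard]
    tauto
  · rw [(mem_powersetCard.1 (mem_filter.1 hS).1).2]

open Classical in
/-- The weighted number of coalitions for which `s, …, t` is a maximal block. -/
theorem sum_isBlock_weight (hα : ∀ i, 1 ≤ α i) {E : Finset (Fin n)} {β : List ℕ}
    (hβ : (β : Multiset ℕ) = E.val.map α) {s t : ℕ} (hs : 1 ≤ s) (hst : s ≤ t) :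
    ∑ S ∈ E.powerset.filter (fun S => IsBlock α S s t), (#S).factorial * (n - 1 - #S).factorial =
      Q β s t (t - s + 1) * R n β s t := by
  set A : Finset (Finset (Fin n)) := (E.powersetCard (t - s + 1)).filter (CarsParkIn α s t)
    with hA
  set B : Finset (Finset (Fin n)) := E.powerset.filter (CarsParkIn α 1 (s - 2)) with hB
  set C : Finset (Finset (Fin n)) := (E.filter (fun i => t + 2 ≤ α i)).powerset with hC
  have hbij : ∑ S ∈ E.powerset.filter (fun S => IsBlock α S s t),
      (#S).factorial * (n - 1 - #S).factorial =
      ∑ T ∈ A ×ˢ (C ×ˢ B), (#T.1 + #T.2.1 + #T.2.2).factorial *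
        (n - 1 - (#T.1 + #T.2.1 + #T.2.2)).factorial := by
    -- A coalition avoiding `s - 1` and `t + 1` is the union of its middle, right and left parts;
    -- `key'` recovers the parts from such a union.
    have key : ∀ S : Finset (Fin n), (∀ i ∈ S, α i + 1 ≠ s ∧ α i ≠ t + 1) →
        S = S.filter (fun i => s ≤ α i ∧ α i ≤ t) ∪ (S.filter (fun i => t + 2 ≤ α i) ∪
          S.filter (fun i => α i + 2 ≤ s)) := by
      intro S hno
      ext i
      simp only [mem_union, mem_filter]
      constructor
      · intro hi
        have := hno i hi
        have : (s ≤ α i ∧ α i ≤ t) ∨ t + 2 ≤ α i ∨ α i + 2 ≤ s := by omega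
        tauto
      · tauto
    have key' : ∀ T ∈ A ×ˢ (C ×ˢ B),
        (T.1 ∪ (T.2.1 ∪ T.2.2)).filter (fun i => s ≤ α i ∧ α i ≤ t) = T.1 ∧
        (T.1 ∪ (T.2.1 ∪ T.2.2)).filter (fun i => t + 2 ≤ α i) = T.2.1 ∧
        (T.1 ∪ (T.2.1 ∪ T.2.2)).filter (fun i => α i + 2 ≤ s) = T.2.2 := by
      intro T hT
      simp only [mem_product, hA, hB, hC, mem_filter, mem_powerset, subset_iff] at hT
      obtain ⟨⟨-, h1, -⟩, h2, -, h3, -⟩ := hT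
      refine ⟨?_, ?_, ?_⟩
      all_goals
        ext i
        have := h1 i
        have := @h2 i
        have := h3 i
        have := hα i
        simp only [mem_filter, mem_union]
        grind
    refine sum_bij' (fun S _ => (S.filter (fun i => s ≤ α i ∧ α i ≤ t),
      S.filter (fun i => t + 2 ≤ α i), S.filter (fun i => α i + 2 ≤ s)))
      (fun T _ => T.1 ∪ (T.2.1 ∪ T.2.2)) ?_ ?_ ?_ ?_ ?_
    · intro S hS
      rw [mem_filter, isBlock_iff hα hs hst, mem_powerset] at hS
      obtain ⟨hSE, -, ⟨h1, h2⟩, h3⟩ := hS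
      simp only [mem_product, hA, hB, hC, mem_filter, mem_powerset, mem_powersetCard]
      exact ⟨⟨⟨(filter_subset _ _).trans hSE, h2⟩, h1⟩, filter_subset_filter _ hSE,
        (filter_subset _ _).trans hSE, h3⟩
    · intro T hT
      obtain ⟨k1, k2, k3⟩ := key' T hT
      rw [mem_filter, isBlock_iff hα hs hst, k1, k3]
      simp only [mem_product, hA, hB, hC, mem_filter, mem_powerset, mem_powersetCard] at hT
      obtain ⟨⟨⟨h1, h2⟩, h3⟩, h4, h5, h6⟩ := hT
      refine ⟨mem_powerset.2 (union_subset h1 (union_subset (h4.trans (filter_subset _ _)) h5)),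
        fun i hi => ?_, ⟨h3, h2⟩, h6⟩
      simp only [mem_union] at hi
      have := hα i
      rcases hi with hi | hi | hi
      · have := h3.1 i hi
        omega
      · have := (mem_filter.1 (h4 hi)).2
        omega
      · have := h6.1 i hi
        omega
    · intro S hS
      rw [mem_filter, isBlock_iff hα hs hst] at hS
      exact (key S hS.2.1).symm
    · intro T hT
      obtain ⟨k1, k2, k3⟩ := key' T hT
      simp only [k1, k2, k3]
    · intro S hS
      rw [mem_filter, isBlock_iff hα hs hst] at hS
      have hc : #S = #(S.filter (fun i => s ≤ α i ∧ α i ≤ t)) +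
          #(S.filter (fun i => t + 2 ≤ α i)) + #(S.filter (fun i => α i + 2 ≤ s)) := by
        conv_lhs => rw [key S hS.2.1]
        rw [card_union_of_disjoint, card_union_of_disjoint, add_assoc]
        · rw [disjoint_filter]
          intro i _
          omega
        · rw [disjoint_union_right, disjoint_filter, disjoint_filter]
          exact ⟨fun i _ => by omega, fun i _ => by omega⟩
      rw [← hc]
  rw [hbij, sum_product]
  -- All middle parts have size `t - s + 1`, so the inner sum is the same for each; right parts give
  -- binomials, left parts the factor `Q β 1 (s - 2) g`.
  have hin : ∀ S₁ ∈ A, ∑ T ∈ C ×ˢ B, (#S₁ + #T.1 + #T.2).factorial *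
        (n - 1 - (#S₁ + #T.1 + #T.2)).factorial = R n β s t := by
    intro S₁ hS₁
    rw [hA, mem_filter, mem_powersetCard] at hS₁
    have hLam : #(E.filter (fun i => t + 2 ≤ α i)) = Lam t β :=
      (countP_eq_card_filter hβ (fun b => t + 2 ≤ b)).symm
    have hGam : #(E.filter (fun i => α i + 2 ≤ s)) = Gam s β :=
      (countP_eq_card_filter hβ (fun b => b + 2 ≤ s)).symm
    rw [hS₁.1.2, sum_product, R]
    have hBsum : ∀ l, ∑ S₃ ∈ B, (t - s + 1 + l + #S₃).factorial *
        (n - 1 - (t - s + 1 + l + #S₃)).factorial = ∑ g ∈ range (Gam s β + 1),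
        Q β 1 (s - 2) g * ((t - s + 1 + l + g).factorial *
          (n - 1 - (t - s + 1 + l + g)).factorial) := by
      intro l
      refine sum_parkIn_card hβ 1 (s - 2) ?_
        (fun g => (t - s + 1 + l + g).factorial * (n - 1 - (t - s + 1 + l + g)).factorial)
      intro S hS hP
      rw [← hGam]
      refine card_le_card fun i hi => mem_filter.2 ⟨mem_powerset.1 hS hi, ?_⟩
      have := hP.1 i hi
      omega
    rw [hC, sum_powerset_apply_card (fun l => ∑ S₃ ∈ B, (t - s + 1 + l + #S₃).factorial *
      (n - 1 - (t - s + 1 + l + #S₃)).factorial), hLam]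
    refine sum_congr rfl fun l _ => ?_
    rw [hBsum, smul_eq_mul, mul_sum]
    refine sum_congr rfl fun g _ => ?_
    rw [show n - 1 - (t - s + 1 + l + g) = n + s - (t + l + g + 2) by omega]
    ring
  rw [sum_congr rfl hin, sum_const, smul_eq_mul, hA, ← Q_eq_card hβ]

theorem numer_eq (α : Fin n → ℕ) (j : Fin n) : numer α j =
    ∑ s ∈ Icc 1 (α j), ∑ t ∈ Icc (α j) (n - 1),
      (t - α j + 1) * Q (others α j) s t (t - s + 1) * R n (others α j) s t := by
  simp only [numer, rearr_rank, others]

theorem shapley_game (hα : IsParkingFunction α) (j : Fin n) :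
    shapley (fun S => (game α S : ℝ)) j = 1 / (n.factorial : ℝ) * (numer α j : ℝ) := by
  classical
  rw [shapley_eq_sum_powerset]
  congr 1
  -- Written with block indicators, the marginal contributions allow the sum over coalitions to be
  -- moved inside the sums over `s` and `t`.
  have hmarg : ∀ S ∈ (univ.erase j).powerset,
      (((#S).factorial * (n - 1 - #S).factorial : ℕ) : ℝ) *
        ((game α (insert j S) : ℝ) - (game α S : ℝ)) =
      ((∑ s ∈ Icc 1 (α j), ∑ t ∈ Icc (α j) (n - 1), (t - α j + 1) *
        (if IsBlock α S s t then (#S).factorial * (n - 1 - #S).factorial else 0) : ℕ) : ℝ) := by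
    intro S hS
    have hj : j ∉ S := fun h => by simpa using mem_powerset.1 hS h
    obtain ⟨p, hap, hpn, hp, hocc⟩ := exists_firstFree hα hj
    rw [game_insert hα hj hap hpn hocc hp, Nat.cast_add, add_sub_cancel_left, ← Nat.cast_mul,
      ← sum_isBlock (hα.mem_Icc j).1 hap hpn hocc hp, mul_sum]
    congr 1
    refine sum_congr rfl fun s _ => ?_
    rw [mul_sum]
    refine sum_congr rfl fun t _ => ?_
    split_ifs <;> ring
  rw [sum_congr rfl hmarg, ← Nat.cast_sum, numer_eq, sum_comm]
  congr 1
  refine sum_congr rfl fun s hs => ?_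
  rw [sum_comm]
  refine sum_congr rfl fun t ht => ?_
  rw [mem_Icc] at hs ht
  rw [← mul_sum, ← sum_filter, sum_isBlock_weight (fun i => (hα.mem_Icc i).1) (coe_others α j)
    hs.1 (hs.2.trans ht.1), mul_assoc]

end Coalitions

end ParkingGame

namespace ParkingGame

/-! ### Computations by random access machines -/

theorem size_add_le (a b : ℕ) : (a + b).size ≤ a.size + b.size + 1 := by
  rw [Nat.size_le, pow_succ, pow_add]
  have ha := Nat.lt_size_self a
  have hb := Nat.lt_size_self b
  nlinarith

theorem size_mul_le (a b : ℕ) : (a * b).size ≤ a.size + b.size := by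
  rw [Nat.size_le, pow_add]
  exact Nat.mul_lt_mul'' (Nat.lt_size_self a) (Nat.lt_size_self b)

theorem size_le_self (a : ℕ) : a.size ≤ a := Nat.size_le.2 Nat.lt_two_pow_self

theorem size_pow_le (b i : ℕ) : (b ^ i).size ≤ i * b.size + 1 := by
  induction i with
  | zero => simp
  | succ i ih =>
    rw [pow_succ]
    have := size_mul_le (b ^ i) b
    linarith

/-- The test holds for exactly `N` rounds; induction on the number of remaining rounds adds up their
costs. -/
theorem run_loop {e : Expr} {p : Prog} {N c c' : ℕ} (Inv : ℕ → Mem → Prop)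
    (hstep : ∀ i < N, ∀ σ, Inv i σ → e.eval σ ≠ 0 ∧ e.cost σ ≤ c ∧
      ∃ τ T, Run p σ τ T ∧ T ≤ c' ∧ Inv (i + 1) τ)
    (hhalt : ∀ σ, Inv N σ → e.eval σ = 0 ∧ e.cost σ ≤ c) {σ : Mem} (hσ : Inv 0 σ) :
    ∃ τ T, Run (.loop e p) σ τ T ∧ T ≤ N * (c + 1 + c') + (c + 1) ∧ Inv N τ := by
  suffices h : ∀ d i, i + d = N → ∀ σ, Inv i σ →
      ∃ τ T, Run (.loop e p) σ τ T ∧ T ≤ d * (c + 1 + c') + (c + 1) ∧ Inv N τ from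
    h N 0 (zero_add N) σ hσ
  intro d
  induction d with
  | zero =>
    rintro i rfl σ hσ
    obtain ⟨h1, h2⟩ := hhalt σ hσ
    exact ⟨σ, _, Run.loop_stop h1, by omega, hσ⟩
  | succ d ih =>
    intro i hi σ hσ
    obtain ⟨h1, h2, τ, T, h3, h4, h5⟩ := hstep i (by omega) σ hσ
    obtain ⟨υ, T', h6, h7, h8⟩ := ih (i + 1) (by omega) τ h5
    refine ⟨υ, _, .loop_step h1 h3 h6, ?_, h8⟩
    rw [Nat.succ_mul]
    omega

/-! ### Polynomial-time functions and their closure properties -/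

/-- A situation in which computations take place, for a family of instances `γ : Γ`: the size and
the input of the instances, and a description of the memories that represent an instance, which
depends only on the banks below `depth`. -/
structure Ctx (Γ : Type) where
  size : Γ → ℕ
  arr : Γ → ℕ → ℕ
  rel : Γ → Mem → Prop
  depth : ℕ
  arr_eq : ∀ {γ σ}, rel γ σ → σ 0 = arr γ
  arr_le : ∀ {γ σ}, rel γ σ → ∀ i, arr γ i ≤ size γ
  stable : ∀ {γ σ τ}, rel γ σ → (∀ b < depth, τ b = σ b) → rel γ τ

namespace Ctx

variable {Γ : Type} (C : Ctx Γ)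

/-- The instances that are represented by some memory. -/
def dom (γ : Γ) : Prop := ∃ σ, C.rel γ σ

/-- `f` is bounded by a polynomial in the size of the instance. -/
def Small (f : Γ → ℕ) : Prop :=
  ∃ p : Polynomial ℕ, ∀ γ, C.dom γ → f γ ≤ p.eval (C.size γ)

/-- `f` is computable in polynomial time: for every `r ≥ C.depth` there is a program which writes
the value of `f` into cell `0` of bank `r` and does not touch the banks below `r`. -/
def Comp (f : Γ → ℕ) : Prop :=
  C.Small (fun γ => (f γ).size) ∧ ∀ r, C.depth ≤ r → ∃ (P : Prog) (B : Γ → ℕ), C.Small B ∧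
    ∀ γ σ, C.rel γ σ → ∃ τ T, Run P σ τ T ∧ T ≤ B γ ∧ τ r 0 = f γ ∧ ∀ b < r, τ b = σ b

variable {C}

theorem Small.mono {f g : Γ → ℕ} (hg : C.Small g) (h : ∀ γ, C.dom γ → f γ ≤ g γ) : C.Small f := by
  obtain ⟨p, hp⟩ := hg
  exact ⟨p, fun γ hγ => (h γ hγ).trans (hp γ hγ)⟩

theorem Small.const (c : ℕ) : C.Small (fun _ => c) := ⟨.C c, by simp⟩

theorem Small.size : C.Small C.size := ⟨.X, by simp⟩

theorem Small.eval (p : Polynomial ℕ) : C.Small (fun γ => p.eval (C.size γ)) :=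
  ⟨p, fun _ _ => le_rfl⟩

theorem Small.add {f g : Γ → ℕ} (hf : C.Small f) (hg : C.Small g) :
    C.Small (fun γ => f γ + g γ) := by
  obtain ⟨p, hp⟩ := hf
  obtain ⟨q, hq⟩ := hg
  refine ⟨p + q, fun γ hγ => ?_⟩
  rw [Polynomial.eval_add]
  exact add_le_add (hp γ hγ) (hq γ hγ)

theorem Small.mul {f g : Γ → ℕ} (hf : C.Small f) (hg : C.Small g) :
    C.Small (fun γ => f γ * g γ) := by
  obtain ⟨p, hp⟩ := hf
  obtain ⟨q, hq⟩ := hg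
  refine ⟨p * q, fun γ hγ => ?_⟩
  rw [Polynomial.eval_mul]
  exact Nat.mul_le_mul (hp γ hγ) (hq γ hγ)

theorem Small.sub {f : Γ → ℕ} (hf : C.Small f) (g : Γ → ℕ) : C.Small (fun γ => f γ - g γ) :=
  hf.mono fun _ _ => Nat.sub_le _ _

theorem Small.arr (f : Γ → ℕ) : C.Small (fun γ => C.arr γ (f γ)) :=
  Small.size.mono fun _ ⟨_, hσ⟩ => C.arr_le hσ _

theorem Comp.congr {f g : Γ → ℕ} (hf : C.Comp f) (h : ∀ γ, C.dom γ → f γ = g γ) : C.Comp g := by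
  refine ⟨hf.1.mono fun γ hγ => by rw [h γ hγ], fun r hr => ?_⟩
  obtain ⟨P, B, hB, hP⟩ := hf.2 r hr
  refine ⟨P, B, hB, fun γ σ hσ => ?_⟩
  rw [← h γ ⟨σ, hσ⟩]
  exact hP γ σ hσ

theorem _root_.ParkingGame.Mem.write_self (σ : Mem) (b i v : ℕ) : σ.write b i v b i = v := by
  simp [Mem.write]

theorem _root_.ParkingGame.Mem.write_of_ne (σ : Mem) {b b' : ℕ} (i v : ℕ) (h : b' ≠ b) :
    σ.write b i v b' = σ b' := by
  funext i'
  simp [Mem.write, h]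

theorem _root_.ParkingGame.Mem.write_of_ne' (σ : Mem) (b : ℕ) {i i' : ℕ} (v : ℕ) (h : i' ≠ i) :
    σ.write b i v b i' = σ b i' := by
  simp [Mem.write, h]

/-- The content of cell `0` of bank `b`. -/
def _root_.ParkingGame.Expr.var (b : ℕ) : Expr := .load b (.const 0)

theorem _root_.ParkingGame.Expr.cost_var (σ : Mem) (b : ℕ) :
    (Expr.var b).cost σ = 2 + (σ b 0).size := by
  simp only [Expr.var, Expr.cost, Expr.eval, Nat.size_zero]
  omega

theorem _root_.ParkingGame.Expr.eval_var (σ : Mem) (b : ℕ) : (Expr.var b).eval σ = σ b 0 := rfl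

theorem Comp.const (c : ℕ) : C.Comp (fun _ => c) := by
  refine ⟨Small.const _, fun r _ => ⟨.store r (.const 0) (.const c), fun _ => 3 + c.size,
    Small.const _, fun γ σ _ => ⟨_, _, .store σ r _ _, ?_, ?_, fun b hb => ?_⟩⟩⟩
  · simp only [Expr.cost, Nat.size_zero]
    omega
  · exact Mem.write_self _ _ _ _
  · exact Mem.write_of_ne _ _ _ hb.ne

/-- The second operand is computed in banks from `r + 1` on, so the first survives in bank `r`. -/
theorem Comp.op {f g : Γ → ℕ} (mk : Expr → Expr → Expr) (op : ℕ → ℕ → ℕ)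
    (heval : ∀ e e' σ, (mk e e').eval σ = op (e.eval σ) (e'.eval σ))
    (hcost : ∀ e e' σ, (mk e e').cost σ =
      e.cost σ + e'.cost σ + (1 + (op (e.eval σ) (e'.eval σ)).size))
    (hsize : ∀ a b, (op a b).size ≤ a.size + b.size + 1)
    (hf : C.Comp f) (hg : C.Comp g) : C.Comp (fun γ => op (f γ) (g γ)) := by
  refine ⟨((hf.1.add hg.1).add (.const 1)).mono fun γ _ => hsize _ _, fun r hr => ?_⟩
  obtain ⟨P, B, hB, hP⟩ := hf.2 r hr
  obtain ⟨P', B', hB', hP'⟩ := hg.2 (r + 1) (by omega)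
  refine ⟨.seq P (.seq P' (.store r (.const 0) (mk (.var r) (.var (r + 1))))),
    fun γ => B γ + (B' γ + (2 * (f γ).size + 2 * (g γ).size + 8)),
    hB.add (hB'.add ((((Small.const 2).mul hf.1).add ((Small.const 2).mul hg.1)).add (.const 8))),
    fun γ σ hσ => ?_⟩
  obtain ⟨τ, T, h1, h2, h3, h4⟩ := hP γ σ hσ
  obtain ⟨τ', T', h1', h2', h3', h4'⟩ :=
    hP' γ τ (C.stable hσ fun b hb => h4 b (by omega))
  have hfr : τ' r 0 = f γ := by rw [h4' r (by omega), h3]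
  refine ⟨_, _, .seq h1 (.seq h1' (.store τ' r _ _)), ?_, ?_, fun b hb => ?_⟩
  · have := hsize (f γ) (g γ)
    rw [hcost, Expr.cost_var, Expr.cost_var, Expr.eval_var, Expr.eval_var, hfr, h3']
    simp only [Expr.cost, Nat.size_zero]
    omega
  · rw [heval, Expr.eval_var, Expr.eval_var, hfr, h3']
    exact Mem.write_self _ _ _ _
  · rw [Mem.write_of_ne _ _ _ hb.ne, h4' b (by omega), h4 b hb]

theorem Comp.add {f g : Γ → ℕ} (hf : C.Comp f) (hg : C.Comp g) : C.Comp (fun γ => f γ + g γ) :=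
  Comp.op .add (· + ·) (fun _ _ _ => rfl) (fun _ _ _ => rfl) size_add_le hf hg

theorem Comp.sub {f g : Γ → ℕ} (hf : C.Comp f) (hg : C.Comp g) : C.Comp (fun γ => f γ - g γ) :=
  Comp.op .sub (· - ·) (fun _ _ _ => rfl) (fun _ _ _ => rfl)
    (fun a b => by have := Nat.size_le_size (Nat.sub_le a b); omega) hf hg

theorem Comp.mul {f g : Γ → ℕ} (hf : C.Comp f) (hg : C.Comp g) : C.Comp (fun γ => f γ * g γ) :=
  Comp.op .mul (· * ·) (fun _ _ _ => rfl) (fun _ _ _ => rfl)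
    (fun a b => by have := size_mul_le a b; omega) hf hg

theorem Comp.div {f g : Γ → ℕ} (hf : C.Comp f) (hg : C.Comp g) : C.Comp (fun γ => f γ / g γ) :=
  Comp.op .div (· / ·) (fun _ _ _ => rfl) (fun _ _ _ => rfl)
    (fun a b => by have := Nat.size_le_size (Nat.div_le_self a b); omega) hf hg

theorem Comp.mod {f g : Γ → ℕ} (hf : C.Comp f) (hg : C.Comp g) : C.Comp (fun γ => f γ % g γ) :=
  (hf.sub (hg.mul (hf.div hg))).congr fun _ _ => (Nat.mod_eq_sub_mul_div).symm

/-- No branching is needed: `1 - ((f - g) + (g - f))` is the indicator of equality. -/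
theorem Comp.ite_eq {f g u v : Γ → ℕ} (hf : C.Comp f) (hg : C.Comp g) (hu : C.Comp u)
    (hv : C.Comp v) : C.Comp (fun γ => if f γ = g γ then u γ else v γ) := by
  have hc := (hf.sub hg).add (hg.sub hf)
  have hc' := (Comp.const 1).sub hc
  refine ((hc'.mul hu).add (((Comp.const 1).sub hc').mul hv)).congr fun γ _ => ?_
  split_ifs with h
  · simp [h]
  · rw [show 1 - (f γ - g γ + (g γ - f γ)) = 0 by omega]
    simp

theorem Comp.ite_le {f g u v : Γ → ℕ} (hf : C.Comp f) (hg : C.Comp g) (hu : C.Comp u)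
    (hv : C.Comp v) : C.Comp (fun γ => if f γ ≤ g γ then u γ else v γ) :=
  ((hf.sub hg).ite_eq (Comp.const 0) hu hv).congr fun _ _ =>
    if_congr Nat.sub_eq_zero_iff_le rfl rfl

theorem Comp.arr {f : Γ → ℕ} (hf : C.Comp f) : C.Comp (fun γ => C.arr γ (f γ)) := by
  have hs : C.Small (fun γ => (C.arr γ (f γ)).size) := (Small.arr f).mono fun _ _ => size_le_self _
  refine ⟨hs, fun r hr => ?_⟩
  obtain ⟨P, B, hB, hP⟩ := hf.2 r hr
  refine ⟨.seq P (.store r (.const 0) (.load 0 (.var r))),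
    fun γ => B γ + ((f γ).size + (C.arr γ (f γ)).size + 5),
    hB.add ((hf.1.add hs).add (.const 5)), fun γ σ hσ => ?_⟩
  obtain ⟨τ, T, h1, h2, h3, h4⟩ := hP γ σ hσ
  have harr : τ 0 = C.arr γ := C.arr_eq (C.stable hσ fun b hb => h4 b (by omega))
  refine ⟨_, _, .seq h1 (.store τ r _ _), ?_, ?_, fun b hb => ?_⟩
  · simp only [Expr.cost, Expr.cost_var, Expr.eval_var, h3, harr, Nat.size_zero]
    omega
  · simp only [Expr.eval, Expr.eval_var, h3, harr, Mem.write_self]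
  · rw [Mem.write_of_ne _ _ _ hb.ne, h4 b hb]

/-- `C'` extends `C` by a loop index running below `N`. -/
structure Extends (C : Ctx Γ) (N : Γ → ℕ) (C' : Ctx (Γ × ℕ)) : Prop where
  size_eq : ∀ q, C'.size q = C.size q.1
  arr_eq : ∀ q, C'.arr q = C.arr q.1
  dom_iff : ∀ q, C'.dom q ↔ C.dom q.1 ∧ q.2 < N q.1
  lift : ∀ {f : Γ → ℕ}, C.Comp f → C'.Comp (fun q => f q.1)
  index : C'.Comp (fun q => q.2)

theorem Extends.small {N : Γ → ℕ} {C' : Ctx (Γ × ℕ)} (h : Extends C N C') {f : Γ → ℕ}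
    (hf : C.Small f) : C'.Small (fun q => f q.1) := by
  obtain ⟨p, hp⟩ := hf
  refine ⟨p, fun q hq => ?_⟩
  rw [h.size_eq]
  exact hp _ ((h.dom_iff q).1 hq).1

theorem Extends.small_index {N : Γ → ℕ} {C' : Ctx (Γ × ℕ)} (h : Extends C N C')
    (hN : C.Small N) : C'.Small (fun q => q.2) :=
  (h.small hN).mono fun q hq => ((h.dom_iff q).1 hq).2.le

/-- The situation inside a loop: bank `r + 1` holds the loop index `i < N`, and bank `r + 2` holds
the value of the accumulator `x`. -/
def ext (C : Ctx Γ) (N : Γ → ℕ) (x : Γ → ℕ → ℕ) (r : ℕ) (hr : C.depth ≤ r) : Ctx (Γ × ℕ) where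
  size q := C.size q.1
  arr q := C.arr q.1
  rel q σ := C.rel q.1 σ ∧ q.2 < N q.1 ∧ σ (r + 1) 0 = q.2 ∧ σ (r + 2) 0 = x q.1 q.2
  depth := r + 3
  arr_eq h := C.arr_eq h.1
  arr_le h := C.arr_le h.1
  stable h hτ := ⟨C.stable h.1 fun b hb => hτ b (by omega), h.2.1,
    by rw [hτ _ (by omega)]; exact h.2.2.1, by rw [hτ _ (by omega)]; exact h.2.2.2⟩

theorem Comp.of_bank {f : Γ → ℕ} (hs : C.Small (fun γ => (f γ).size)) {b : ℕ}
    (h : ∀ γ σ, C.rel γ σ → σ b 0 = f γ) : C.Comp f := by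
  refine ⟨hs, fun r hr => ⟨.store r (.const 0) (.var b), fun γ => (f γ).size + 4,
    hs.add (.const 4), fun γ σ hσ => ⟨_, _, .store σ r _ _, ?_, ?_, fun b' hb' => ?_⟩⟩⟩
  · rw [Expr.cost_var, h γ σ hσ]
    simp only [Expr.cost, Nat.size_zero]
    omega
  · rw [Expr.eval_var, h γ σ hσ]
    exact Mem.write_self _ _ _ _
  · exact Mem.write_of_ne _ _ _ hb'.ne

theorem extends_ext {N : Γ → ℕ} (hN : C.Small N) (x : Γ → ℕ → ℕ) (r : ℕ) (hr : C.depth ≤ r) :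
    Extends C N (C.ext N x r hr) := by
  have hdom : ∀ q, (C.ext N x r hr).dom q ↔ C.dom q.1 ∧ q.2 < N q.1 := by
    intro q
    constructor
    · rintro ⟨σ, h1, h2, -⟩
      exact ⟨⟨σ, h1⟩, h2⟩
    · rintro ⟨⟨σ, hσ⟩, hq⟩
      -- Writing index and accumulator into banks above `C.depth` does not disturb the
      -- representation of the instance.
      refine ⟨(σ.write (r + 1) 0 q.2).write (r + 2) 0 (x q.1 q.2), C.stable hσ fun b hb => ?_, hq,
        ?_, Mem.write_self _ _ _ _⟩
      · rw [Mem.write_of_ne _ _ _ (by omega), Mem.write_of_ne _ _ _ (by omega)]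
      · rw [Mem.write_of_ne _ _ _ (by omega), Mem.write_self]
  have hsmall : ∀ {f : Γ → ℕ}, C.Small f → (C.ext N x r hr).Small (fun q => f q.1) := by
    rintro f ⟨p, hp⟩
    exact ⟨p, fun q hq => hp _ ((hdom q).1 hq).1⟩
  refine ⟨fun _ => rfl, fun _ => rfl, hdom, fun {f} hf => ⟨hsmall hf.1, fun r' hr' => ?_⟩, ?_⟩
  · have hr'' : r + 3 ≤ r' := hr'
    obtain ⟨P, B, hB, hP⟩ := hf.2 r' (by omega)
    exact ⟨P, fun q => B q.1, hsmall hB, fun q σ hσ => hP q.1 σ hσ.1⟩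
  · refine Comp.of_bank ((hsmall hN).mono fun q hq => ?_) (b := r + 1) (fun q σ hσ => hσ.2.2.1)
    exact (size_le_self _).trans ((hdom q).1 hq).2.le

/-- Computation of the terms of a sequence by iteration of a step function. -/
theorem Comp.iter {N : Γ → ℕ} (hN : C.Comp N) (hNs : C.Small N) (x : Γ → ℕ → ℕ)
    {b : Γ → ℕ} (hb : C.Small b) (hxb : ∀ γ, C.dom γ → ∀ i ≤ N γ, (x γ i).size ≤ b γ)
    (h0 : C.Comp (fun γ => x γ 0))
    (hstep : ∀ C', Extends C N C' → C'.Comp (fun q => x q.1 q.2) →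
      C'.Comp (fun q => x q.1 (q.2 + 1))) :
    C.Comp (fun γ => x γ (N γ)) := by
  refine ⟨hb.mono fun γ hγ => hxb γ hγ _ le_rfl, fun r hr => ?_⟩
  -- Bank `r` keeps `N`, bank `r + 1` the counter and bank `r + 2` the current term; the body works
  -- from bank `r + 3` on.
  obtain ⟨PN, BN, hBN, hPN⟩ := hN.2 r hr
  obtain ⟨P0, B0, hB0, hP0⟩ := h0.2 (r + 2) (by omega)
  have hext := extends_ext hNs x r hr
  have hx : (C.ext N x r hr).Comp (fun q => x q.1 q.2) :=
    Comp.of_bank ((hext.small hb).mono fun q hq =>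
        hxb _ ((hext.dom_iff q).1 hq).1 _ ((hext.dom_iff q).1 hq).2.le)
      (b := r + 2) (fun q σ hσ => hσ.2.2.2)
  obtain ⟨P, B, ⟨p, hp⟩, hP⟩ := (hstep _ hext hx).2 (r + 3) le_rfl
  refine ⟨.seq PN (.seq (.store (r + 1) (.const 0) (.const 0)) (.seq P0
    (.seq (.loop (.sub (.var r) (.var (r + 1))) (.seq P
      (.seq (.store (r + 2) (.const 0) (.var (r + 3)))
        (.store (r + 1) (.const 0) (.add (.var (r + 1)) (.const 1))))))
      (.store r (.const 0) (.var (r + 2)))))),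
    fun γ => BN γ + (3 + (B0 γ + ((N γ * ((3 * N γ + 5) + 1 +
      (p.eval (C.size γ) + ((b γ + 4) + (2 * N γ + 10)))) + ((3 * N γ + 5) + 1)) + (b γ + 4)))),
    hBN.add ((Small.const 3).add (hB0.add (((hNs.mul (((((Small.const 3).mul hNs).add
      (.const 5)).add (.const 1)).add ((Small.eval p).add ((hb.add (.const 4)).add
      (((Small.const 2).mul hNs).add (.const 10)))))).add ((((Small.const 3).mul hNs).add
      (.const 5)).add (.const 1))).add (hb.add (.const 4))))), fun γ σ hσ => ?_⟩
  have hγ : C.dom γ := ⟨σ, hσ⟩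
  obtain ⟨τ₁, T₁, h1, h2, h3, h4⟩ := hPN γ σ hσ
  have hrun2 := Run.store τ₁ (r + 1) (.const 0) (.const 0)
  set τ₂ := τ₁.write (r + 1) ((Expr.const 0).eval τ₁) ((Expr.const 0).eval τ₁) with hτ₂
  have hfr2 : ∀ b < r + 1, τ₂ b = τ₁ b := fun b hb => Mem.write_of_ne _ _ _ hb.ne
  obtain ⟨τ₃, T₃, h5, h6, h7, h8⟩ := hP0 γ τ₂ (C.stable hσ fun b hb => by
    rw [hfr2 b (by omega), h4 b (by omega)])
  let Inv : ℕ → Mem → Prop := fun i υ => (∀ b < r, υ b = σ b) ∧ υ r 0 = N γ ∧ υ (r + 1) 0 = i ∧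
    υ (r + 2) 0 = x γ i
  have htest : ∀ i ≤ N γ, ∀ υ, Inv i υ →
      (Expr.sub (.var r) (.var (r + 1))).eval υ = N γ - i ∧
      (Expr.sub (.var r) (.var (r + 1))).cost υ ≤ 3 * N γ + 5 := by
    rintro i hi υ ⟨-, e2, e3, -⟩
    rw [Expr.eval, Expr.cost, Expr.cost_var, Expr.cost_var, Expr.eval_var, Expr.eval_var, e2, e3]
    have s1 := size_le_self (N γ)
    have s2 := size_le_self i
    have s3 := size_le_self (N γ - i)
    exact ⟨rfl, by omega⟩
  have hInv0 : Inv 0 τ₃ := by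
    refine ⟨fun b hb => ?_, ?_, ?_, h7⟩
    · rw [h8 b (by omega), hfr2 b (by omega), h4 b hb]
    · rw [h8 r (by omega), hfr2 r (by omega), h3]
    · rw [h8 _ (by omega), hτ₂]
      exact Mem.write_self _ _ _ _
  obtain ⟨τ₄, T₄, h9, h10, e1, e2, e3, e4⟩ := run_loop (N := N γ) (c := 3 * N γ + 5)
    (c' := p.eval (C.size γ) + ((b γ + 4) + (2 * N γ + 10)))
    (e := .sub (.var r) (.var (r + 1)))
    (p := .seq P (.seq (.store (r + 2) (.const 0) (.var (r + 3)))
        (.store (r + 1) (.const 0) (.add (.var (r + 1)) (.const 1))))) Inv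
    (by
      intro i hi υ hυ
      obtain ⟨t1, t2⟩ := htest i hi.le υ hυ
      refine ⟨by rw [t1]; omega, t2, ?_⟩
      obtain ⟨u1, u2, u3, u4⟩ := hυ
      have hrel : (C.ext N x r hr).rel (γ, i) υ :=
        ⟨C.stable hσ fun b hb => u1 b (by omega), hi, u3, u4⟩
      obtain ⟨υ₁, S, v1, v2, v3, v4⟩ := hP (γ, i) υ hrel
      have hS := v2.trans (hp (γ, i) ⟨υ, hrel⟩)
      refine ⟨_, _, .seq v1 (.seq (.store _ _ _ _) (.store _ _ _ _)), ?_, ?_, ?_, ?_, ?_⟩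
      · have hw : ∀ v, υ₁.write (r + 2) 0 v (r + 1) 0 = i := fun v => by
          rw [Mem.write_of_ne _ _ _ (by omega), v4 (r + 1) (by omega), u3]
        have s1 := hxb γ hγ (i + 1) hi
        have s2 := size_le_self i
        have s3 := size_le_self (i + 1)
        simp only [Expr.cost, Expr.eval, Expr.cost_var, Expr.eval_var, hw, v3, Nat.size_zero,
          Nat.size_one]
        change S ≤ p.eval (C.size γ) at hS
        omega
      · intro b hb
        rw [Mem.write_of_ne _ _ _ (by omega), Mem.write_of_ne _ _ _ (by omega), v4 b (by omega),
          u1 b hb]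
      · rw [Mem.write_of_ne _ _ _ (by omega), Mem.write_of_ne _ _ _ (by omega), v4 r (by omega),
          u2]
      · simp only [Expr.eval, Expr.eval_var, Mem.write_self]
        rw [Mem.write_of_ne _ _ _ (by omega), v4 _ (by omega), u3]
      · rw [Mem.write_of_ne _ _ _ (by omega), Expr.eval, Mem.write_self, Expr.eval_var, v3])
    (fun υ hυ => ⟨by rw [(htest _ le_rfl υ hυ).1, Nat.sub_self], (htest _ le_rfl υ hυ).2⟩) hInv0
  refine ⟨_, _, .seq h1 (.seq hrun2 (.seq h5 (.seq h9 (.store τ₄ r _ _)))), ?_, ?_,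
    fun b hb => ?_⟩
  · rw [Expr.cost_var, e4]
    have := hxb γ hγ (N γ) le_rfl
    simp only [Expr.cost, Nat.size_zero]
    omega
  · rw [Expr.eval_var, e4]
    exact Mem.write_self _ _ _ _
  · rw [Mem.write_of_ne _ _ _ hb.ne, e1 b hb]

theorem Comp.sum {N : Γ → ℕ} (hN : C.Comp N) (hNs : C.Small N) (f : Γ → ℕ → ℕ)
    (hf : ∀ C', Extends C N C' → C'.Comp (fun q => f q.1 q.2)) :
    C.Comp (fun γ => ∑ i ∈ Finset.range (N γ), f γ i) := by
  -- This context with a dummy accumulator only serves to bound the sizes of all terms by one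
  -- polynomial.
  have hext := extends_ext hNs (fun _ _ => 0) C.depth le_rfl
  obtain ⟨p, hp⟩ := (hf _ hext).1
  have hbound : ∀ γ, C.dom γ → ∀ i < N γ, (f γ i).size ≤ p.eval (C.size γ) := fun γ hγ i hi =>
    hp (γ, i) ((hext.dom_iff (γ, i)).2 ⟨hγ, hi⟩)
  refine Comp.iter hN hNs (fun γ i => ∑ k ∈ Finset.range i, f γ k)
    (hNs.add (Small.eval p)) (fun γ hγ i hi => ?_) (by simpa using Comp.const 0)
    (fun C' hC' hx => (hx.add (hf C' hC')).congr fun q _ => (Finset.sum_range_succ _ _).symm)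
  have h1 : ∑ k ∈ Finset.range i, f γ k ≤ i * 2 ^ p.eval (C.size γ) := by
    rw [← smul_eq_mul]
    refine (Finset.sum_le_card_nsmul _ _ _ fun k hk => ?_).trans_eq (by rw [Finset.card_range])
    have := hbound γ hγ k (by have := Finset.mem_range.1 hk; omega)
    exact (Nat.size_le.1 this).le
  rw [Nat.size_le, pow_add]
  refine h1.trans_lt (Nat.mul_lt_mul_of_pos_right ?_ (by positivity))
  exact hi.trans_lt Nat.lt_two_pow_self

theorem Comp.pow {f N : Γ → ℕ} (hf : C.Comp f) (hN : C.Comp N) (hNs : C.Small N) :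
    C.Comp (fun γ => f γ ^ N γ) := by
  refine Comp.iter hN hNs (fun γ i => f γ ^ i) ((hNs.mul hf.1).add (.const 1))
    (fun γ _ i hi => (size_pow_le _ _).trans ?_) (by simpa using Comp.const 1)
    (fun C' hC' hx => hx.mul (hC'.lift hf))
  exact Nat.add_le_add_right (Nat.mul_le_mul_right _ hi) 1

theorem Comp.factorial {N : Γ → ℕ} (hN : C.Comp N) (hNs : C.Small N) :
    C.Comp (fun γ => (N γ).factorial) := by
  refine Comp.iter hN hNs (fun _ i => i.factorial) ((hNs.mul hNs).add (.const 1))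
    (fun γ _ i hi => ?_) (by simpa using Comp.const 1)
    (fun C' hC' hx => ((hC'.index.add (.const 1)).mul hx).congr
      fun q _ => (Nat.factorial_succ _).symm)
  refine (Nat.size_le_size i.factorial_le_pow).trans ((size_pow_le _ _).trans ?_)
  exact Nat.add_le_add_right (Nat.mul_le_mul hi ((size_le_self i).trans hi)) 1

theorem Comp.choose {f g : Γ → ℕ} (hf : C.Comp f) (hfs : C.Small f) (hg : C.Comp g)
    (hgs : C.Small g) : C.Comp (fun γ => (f γ).choose (g γ)) := by
  refine (hg.ite_le hf ((hf.factorial hfs).div ((hg.factorial hgs).mul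
    ((hf.sub hg).factorial (hfs.sub g)))) (.const 0)).congr fun γ _ => ?_
  split_ifs with h
  · exact (Nat.choose_eq_factorial_div_factorial h).symm
  · exact (Nat.choose_eq_zero_of_lt (by omega)).symm

end Ctx

/-! ### An encoding of the numbers `Q β s t k` for all `k` by a single number -/

theorem sum_mul_pow_lt {B : ℕ} {f : ℕ → ℕ} (hf : ∀ c, f c < B) (d : ℕ) :
    ∑ c ∈ Finset.range d, f c * B ^ c < B ^ d := by
  induction d with
  | zero => simp
  | succ d ih =>
    rw [Finset.sum_range_succ, pow_succ]
    have := hf d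
    have h : (f d + 1) * B ^ d ≤ B * B ^ d := Nat.mul_le_mul_right _ this
    nlinarith

/-- The digits from position `d` on form a multiple of `B ^ d`, and the lower ones sum to less than
`B ^ d`. -/
theorem sum_mul_pow_mod {B : ℕ} {f : ℕ → ℕ} (hf : ∀ c, f c < B) (K d : ℕ) :
    (∑ c ∈ Finset.range K, f c * B ^ c) % B ^ d =
      ∑ c ∈ Finset.range K, if c < d then f c * B ^ c else 0 := by
  have hsplit : ∑ c ∈ Finset.range K, f c * B ^ c =
      (∑ c ∈ Finset.range K, if c < d then f c * B ^ c else 0) +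
        B ^ d * ∑ c ∈ Finset.range K, if c < d then 0 else f c * B ^ (c - d) := by
    rw [Finset.mul_sum, ← Finset.sum_add_distrib]
    refine Finset.sum_congr rfl fun c _ => ?_
    split_ifs with h
    · simp
    · rw [zero_add, mul_left_comm, ← pow_add, Nat.add_sub_cancel' (by omega)]
  have hlt : (∑ c ∈ Finset.range K, if c < d then f c * B ^ c else 0) < B ^ d := by
    refine lt_of_le_of_lt ?_ (sum_mul_pow_lt hf d)
    rw [← Finset.sum_filter]
    refine Finset.sum_le_sum_of_subset fun c hc => ?_
    simp only [Finset.mem_filter] at hc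
    exact Finset.mem_range.2 hc.2
  rw [hsplit, Nat.add_mul_mod_self_left, Nat.mod_eq_of_lt hlt]

theorem sum_mul_pow_div_mod {B : ℕ} (hB : 0 < B) {f : ℕ → ℕ} (hf : ∀ c, f c < B) {K d : ℕ}
    (hd : d < K) : (∑ c ∈ Finset.range K, f c * B ^ c) / B ^ d % B = f d := by
  rw [← Nat.mod_mul_right_div_self, ← pow_succ, sum_mul_pow_mod hf,
    ← Finset.add_sum_erase _ _ (Finset.mem_range.2 hd), if_pos (Nat.lt_succ_self d)]
  have h : ∑ c ∈ (Finset.range K).erase d, (if c < d + 1 then f c * B ^ c else 0) =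
      (∑ c ∈ Finset.range K, f c * B ^ c) % B ^ d := by
    rw [sum_mul_pow_mod hf, ← Finset.add_sum_erase _ _ (Finset.mem_range.2 hd),
      if_neg (lt_irrefl d), zero_add]
    refine Finset.sum_congr rfl fun c hc => ?_
    have := (Finset.mem_erase.1 hc).1
    exact if_congr (by omega) rfl rfl
  have hpos : 0 < B ^ d := by positivity
  rw [h, add_comm, Nat.add_mul_div_right _ _ hpos, Nat.div_eq_of_lt (Nat.mod_lt _ hpos), zero_add]

/-- The numbers `Q l s t k`, as digits in base `B`, for an increasing list `l` of entries in
`s, …, t`. -/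
def enc (t B : ℕ) : List ℕ → ℕ
  | [] => 1
  | b :: l => enc t B l + B * (enc t B l % B ^ (t - b + 1))

theorem Q_le_two_pow (l : List ℕ) (s t k : ℕ) : Q l s t k ≤ 2 ^ l.length :=
  List.countP_le_length.trans ((List.length_sublistsLen _ _).trans_le (Nat.choose_le_two_pow _ _))

/-- This is `Q_cons_succ` for generating functions at `B`: selecting `b` multiplies by `B`, and `b +
k ≤ t` keeps the digits `k < t - b + 1`. Digits never overflow, by `Q_le_two_pow`. -/
theorem enc_eq_sum {l : List ℕ} (hl : l.Pairwise (· ≤ ·)) {s t B : ℕ}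
    (hst : ∀ b ∈ l, s ≤ b ∧ b ≤ t) (hB : 2 ^ l.length < B) {K : ℕ} (hK : l.length < K) :
    enc t B l = ∑ c ∈ Finset.range K, Q l s t c * B ^ c := by
  induction l generalizing K with
  | nil =>
    obtain ⟨K, rfl⟩ := Nat.exists_eq_succ_of_ne_zero hK.ne'
    rw [Finset.sum_range_succ', Q_zero]
    simp [enc, Q_nil_succ]
  | cons b l ih =>
    rw [List.pairwise_cons] at hl
    rw [List.forall_mem_cons] at hst
    rw [List.length_cons] at hB hK
    have hB' : 2 ^ l.length < B := lt_of_le_of_lt (Nat.pow_le_pow_right (by norm_num) (by omega)) hB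
    obtain ⟨K, rfl⟩ := Nat.exists_eq_succ_of_ne_zero (by omega : K ≠ 0)
    have hK' : l.length < K := by omega
    -- The untruncated copy is expanded with one more term, to match the copy shifted by one digit.
    rw [enc, ih hl.2 hst.2 hB' hK', sum_mul_pow_mod
      (fun c => (Q_le_two_pow l s t c).trans_lt hB'), ← ih hl.2 hst.2 hB' hK',
      ih hl.2 hst.2 hB' (K := K + 1) (by omega), Finset.sum_range_succ', Finset.sum_range_succ',
      Q_zero, Q_zero, add_right_comm, Finset.mul_sum, ← Finset.sum_add_distrib]
    congr 1
    refine Finset.sum_congr rfl fun c _ => ?_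
    rw [Q_cons_succ hl.1, add_mul]
    congr 1
    by_cases h : b + c ≤ t
    · rw [if_pos (by omega), if_pos ⟨hst.1.1, h⟩, pow_succ]
      ring
    · rw [if_neg (by omega), if_neg (by omega), mul_zero, zero_mul]

theorem enc_div_mod {l : List ℕ} (hl : l.Pairwise (· ≤ ·)) {s t B : ℕ}
    (hst : ∀ b ∈ l, s ≤ b ∧ b ≤ t) (hB : 2 ^ l.length < B) (k : ℕ) :
    enc t B l / B ^ k % B = Q l s t k := by
  rw [enc_eq_sum hl hst hB (K := l.length + k + 1) (by omega)]
  exact sum_mul_pow_div_mod (Nat.zero_lt_of_lt hB) (fun c => (Q_le_two_pow l s t c).trans_lt hB) (by omega)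

theorem enc_le (t B : ℕ) (l : List ℕ) : enc t B l ≤ (1 + B) ^ l.length := by
  induction l with
  | nil => simp [enc]
  | cons b l ih =>
    have h := Nat.mod_le (enc t B l) (B ^ (t - b + 1))
    calc enc t B l + B * (enc t B l % B ^ (t - b + 1)) ≤ enc t B l + B * enc t B l := by gcongr
      _ = enc t B l * (1 + B) := by ring
      _ ≤ (1 + B) ^ l.length * (1 + B) := by gcongr
      _ = _ := by rw [List.length_cons, pow_succ]

theorem Q_filter {β : List ℕ} (hβ : β.Pairwise (· ≤ ·)) (s t k : ℕ) :
    Q β s t k = Q (β.filter (fun b => decide (s ≤ b ∧ b ≤ t))) s t k := by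
  induction β generalizing k with
  | nil => rfl
  | cons b l ih =>
    rw [List.pairwise_cons] at hβ
    cases k with
    | zero => rw [Q_zero, Q_zero]
    | succ k =>
      rw [Q_cons_succ hβ.1]
      by_cases h : s ≤ b ∧ b ≤ t
      · rw [List.filter_cons_of_pos (by simpa using h),
          Q_cons_succ fun a ha => hβ.1 a (List.mem_of_mem_filter ha), ← ih hβ.2, ← ih hβ.2]
      · rw [List.filter_cons_of_neg (by simpa using h), if_neg (by omega), ← ih hβ.2, add_zero]

/-- The increasing list of entries `t - q + 1, …, t` with multiplicities given by `M`. -/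
def blocks (t : ℕ) (M : ℕ → ℕ) : ℕ → List ℕ
  | 0 => []
  | q + 1 => List.replicate (M (t - q)) (t - q) ++ blocks t M q

theorem mem_blocks {t : ℕ} {M : ℕ → ℕ} {q b : ℕ} (h : b ∈ blocks t M q) : t < b + q ∧ b ≤ t := by
  induction q with
  | zero => simp [blocks] at h
  | succ q ih =>
    rw [blocks, List.mem_append, List.mem_replicate] at h
    rcases h with h | h
    · omega
    · have := ih h
      omega

theorem pairwise_blocks (t : ℕ) (M : ℕ → ℕ) (q : ℕ) : (blocks t M q).Pairwise (· ≤ ·) := by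
  induction q with
  | zero => exact List.Pairwise.nil
  | succ q ih =>
    rw [blocks, List.pairwise_append]
    refine ⟨List.pairwise_replicate.2 (Or.inr le_rfl), ih, fun a ha b hb => ?_⟩
    have := List.eq_of_mem_replicate ha
    have := mem_blocks hb
    omega

theorem count_blocks (t : ℕ) (M : ℕ → ℕ) {q : ℕ} (hq : q ≤ t + 1) (v : ℕ) :
    (blocks t M q).count v = if t < v + q ∧ v ≤ t then M v else 0 := by
  induction q with
  | zero =>
    rw [if_neg (by omega)]
    rfl
  | succ q ih =>
    rw [blocks, List.count_append, ih (by omega), List.count_replicate]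
    by_cases h : t - q = v
    · rw [if_pos (by simpa using h), if_neg (by omega), if_pos (by omega), h, add_zero]
    · rw [if_neg (by simpa using h), zero_add]
      exact if_congr (by omega) rfl rfl

theorem length_blocks_le {t : ℕ} {M : ℕ → ℕ} {n : ℕ} (hM : ∀ v, M v ≤ n) (q : ℕ) :
    (blocks t M q).length ≤ q * n := by
  induction q with
  | zero => simp [blocks]
  | succ q ih =>
    rw [blocks, List.length_append, List.length_replicate, Nat.succ_mul]
    have := hM (t - q)
    omega

/-- A sorted list is determined by its multiplicities, so the machine can count instead of sorting.
-/
theorem blocks_eq_filter {β : List ℕ} (hβ : β.Pairwise (· ≤ ·)) (s t : ℕ) :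
    blocks t (fun v => β.count v) (t + 1 - s) =
      β.filter (fun b => decide (s ≤ b ∧ b ≤ t)) := by
  refine List.Perm.eq_of_pairwise (le := (· ≤ ·)) (fun a b _ _ h1 h2 => le_antisymm h1 h2)
    (pairwise_blocks _ _ _) (hβ.filter _) ?_
  rw [List.perm_iff_count]
  intro v
  rw [count_blocks _ _ (by omega)]
  by_cases h : s ≤ v ∧ v ≤ t
  · rw [if_pos (by omega), List.count_filter (by simpa using h)]
  · rw [if_neg (by omega), eq_comm, List.count_eq_zero]
    intro hv
    exact h (by simpa using List.of_mem_filter hv)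

/-! ### The closed formula in terms of the input memory -/

/-- The number of the entries `A 1, …, A n` other than entry `j + 1` that satisfy `p`. -/
def countOthers (n : ℕ) (A : ℕ → ℕ) (j : ℕ) (p : ℕ → Prop) [DecidablePred p] : ℕ :=
  ∑ i ∈ Finset.range n, if i = j then 0 else if p (A (i + 1)) then 1 else 0

theorem countOthers_le (n : ℕ) (A : ℕ → ℕ) (j : ℕ) (p : ℕ → Prop) [DecidablePred p] :
    countOthers n A j p ≤ n := by
  refine (Finset.sum_le_card_nsmul _ _ 1 fun i _ => ?_).trans_eq (by simp)
  split_ifs <;> simp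

theorem input_zero {n : ℕ} (α : Fin n → ℕ) : input α 0 0 = n := by simp [input]

theorem input_succ {n : ℕ} (α : Fin n → ℕ) (i : Fin n) : input α 0 (i + 1) = α i := by
  simp [input]

theorem countP_others {n : ℕ} (α : Fin n → ℕ) (j : Fin n) (p : ℕ → Prop) [DecidablePred p] :
    (others α j).countP (fun b => decide (p b)) = countOthers n (input α 0) j p := by
  rw [countP_eq_card_filter (coe_others α j), countOthers, Finset.card_filter,
    Finset.sum_range, ← Finset.add_sum_erase _ _ (Finset.mem_univ j), if_pos rfl, zero_add]
  refine Finset.sum_congr rfl fun i hi => ?_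
  rw [if_neg fun h => (Finset.mem_erase.1 hi).1 (Fin.ext h), input_succ]

theorem length_others {n : ℕ} (α : Fin n → ℕ) (j : Fin n) : (others α j).length = n - 1 := by
  rw [others, List.length_eraseIdx_of_lt (by simp), List.length_ofFn]

/-- `Q` for the entries `A 1, …, A n` without entry `j + 1`. -/
def computeQ (n : ℕ) (A : ℕ → ℕ) (j s t k : ℕ) : ℕ :=
  enc t (2 ^ (n + 1)) (blocks t (fun v => countOthers n A j (· = v)) (t + 1 - s)) /
    (2 ^ (n + 1)) ^ k % 2 ^ (n + 1)

theorem computeQ_eq {n : ℕ} (α : Fin n → ℕ) (j : Fin n) (s t k : ℕ) :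
    computeQ n (input α 0) j s t k = Q (others α j) s t k := by
  have hcount : (fun v => countOthers n (input α 0) j (· = v)) = fun v => (others α j).count v := by
    funext v
    rw [← countP_others, List.count]
    refine List.countP_congr fun b _ => ?_
    simp
  rw [computeQ, hcount, blocks_eq_filter (pairwise_others α j), Q_filter (pairwise_others α j)]
  refine enc_div_mod ((pairwise_others α j).filter _)
    (fun b hb => by simpa using List.of_mem_filter hb) ?_ k
  refine Nat.pow_lt_pow_right (by norm_num) ?_
  have h1 := List.length_filter_le (fun b => decide (s ≤ b ∧ b ≤ t)) (others α j)
  have h2 := length_others α j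
  omega

/-- `R` for the entries `A 1, …, A n` without entry `j + 1`. -/
def computeR (n : ℕ) (A : ℕ → ℕ) (j s t : ℕ) : ℕ :=
  ∑ l ∈ Finset.range (countOthers n A j (fun b => t + 2 ≤ b) + 1),
    ∑ g ∈ Finset.range (countOthers n A j (fun b => b + 2 ≤ s) + 1),
      (countOthers n A j (fun b => t + 2 ≤ b)).choose l * computeQ n A j 1 (s - 2) g *
        (t - s + 1 + l + g).factorial * (n + s - (t + l + g + 2)).factorial

theorem computeR_eq {n : ℕ} (α : Fin n → ℕ) (j : Fin n) (s t : ℕ) :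
    computeR n (input α 0) j s t = R n (others α j) s t := by
  simp only [computeR, R, Lam, Gam, computeQ_eq, countP_others]

/-- The closed formula for car `j + 1` of the cars with preferences `A 1, …, A n`. -/
def computeNumer (n : ℕ) (A : ℕ → ℕ) (j : ℕ) : ℕ :=
  ∑ s ∈ Finset.range (A (j + 1)), ∑ t ∈ Finset.range (n - A (j + 1)),
    (t + 1) * computeQ n A j (1 + s) (A (j + 1) + t) (A (j + 1) + t - (1 + s) + 1) *
      computeR n A j (1 + s) (A (j + 1) + t)

theorem computeNumer_eq {n : ℕ} {α : Fin n → ℕ} (hα : IsParkingFunction α) (j : Fin n) :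
    computeNumer n (input α 0) j = numer α j := by
  obtain ⟨h1, h2⟩ := hα.mem_Icc j
  have e1 : Finset.Icc 1 (α j) = Finset.Ico 1 (α j + 1) := by ext; simp
  have e2 : Finset.Icc (α j) (n - 1) = Finset.Ico (α j) n := by ext; simp; omega
  rw [numer_eq, e1, e2, computeNumer, input_succ, Finset.sum_Ico_eq_sum_range,
    Nat.add_sub_cancel]
  refine Finset.sum_congr rfl fun s _ => ?_
  rw [Finset.sum_Ico_eq_sum_range]
  refine Finset.sum_congr rfl fun t _ => ?_
  rw [computeQ_eq, computeR_eq, Nat.add_sub_cancel_left]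

/-! ### Polynomial-time computation of the closed formula -/

namespace Ctx

variable {Γ : Type} {C : Ctx Γ}

/-- `f` is computable in polynomial time and bounded by a polynomial in the size of the instance,
so that it can serve as a loop bound. -/
def Index (C : Ctx Γ) (f : Γ → ℕ) : Prop := C.Comp f ∧ C.Small f

theorem Index.const (c : ℕ) : C.Index (fun _ => c) := ⟨.const c, .const c⟩

theorem Index.add {f g : Γ → ℕ} (hf : C.Index f) (hg : C.Index g) :
    C.Index (fun γ => f γ + g γ) := ⟨hf.1.add hg.1, hf.2.add hg.2⟩

theorem Index.sub {f g : Γ → ℕ} (hf : C.Index f) (hg : C.Index g) :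
    C.Index (fun γ => f γ - g γ) := ⟨hf.1.sub hg.1, hf.2.sub g⟩

theorem Index.arr {f : Γ → ℕ} (hf : C.Index f) : C.Index (fun γ => C.arr γ (f γ)) :=
  ⟨hf.1.arr, .arr f⟩

theorem Index.factorial {f : Γ → ℕ} (hf : C.Index f) : C.Comp (fun γ => (f γ).factorial) :=
  hf.1.factorial hf.2

theorem Index.sum {N : Γ → ℕ} (hN : C.Index N) {f : Γ → ℕ → ℕ}
    (hf : ∀ C', Extends C N C' → C'.Comp (fun q => f q.1 q.2)) :
    C.Comp (fun γ => ∑ i ∈ Finset.range (N γ), f γ i) := hN.1.sum hN.2 f hf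

theorem Extends.liftIndex {N : Γ → ℕ} {C' : Ctx (Γ × ℕ)} (h : Extends C N C') {f : Γ → ℕ}
    (hf : C.Index f) : C'.Index (fun q => f q.1) := ⟨h.lift hf.1, h.small hf.2⟩

theorem Extends.loopIndex {N : Γ → ℕ} {C' : Ctx (Γ × ℕ)} (h : Extends C N C')
    (hN : C.Index N) : C'.Index (fun q => q.2) := ⟨h.index, h.small_index hN.2⟩

theorem Extends.index_size {N : Γ → ℕ} {C' : Ctx (Γ × ℕ)} (h : Extends C N C')
    (hn : C.Index C.size) : C'.Index C'.size := by
  have := h.liftIndex hn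
  rwa [← funext h.size_eq] at this

theorem Index.countOthers (hn : C.Index C.size) {j : Γ → ℕ} (hj : C.Index j) (p : Γ → ℕ → Prop)
    [∀ γ, DecidablePred (p γ)]
    (hp : ∀ C', Extends C C.size C' → ∀ {e : Γ × ℕ → ℕ}, C'.Comp e →
      C'.Comp (fun q => if p q.1 (e q) then 1 else 0)) :
    C.Index (fun γ => countOthers (C.size γ) (C.arr γ) (j γ) (p γ)) := by
  refine ⟨hn.sum fun C' h => ?_, hn.2.mono fun γ _ => countOthers_le _ _ _ _⟩
  have harr := (h.index.add (.const 1)).arr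
  simp only [h.arr_eq] at harr
  exact h.index.ite_eq (h.lift hj.1) (.const 0) (hp C' h harr)

theorem _root_.ParkingGame.size_one_add_two_pow_le (m : ℕ) : (1 + 2 ^ m).size ≤ m + 2 := by
  rw [Nat.size_le, pow_add]
  have := Nat.one_le_two_pow (n := m)
  omega

/-- Two nested iterations follow the recursion of `enc`: the outer runs down through the values `t -
q`, the inner adds the copies of one value. -/
theorem Comp.computeQ (hn : C.Index C.size) {j s t k : Γ → ℕ} (hj : C.Index j) (hs : C.Index s)
    (ht : C.Index t) (hk : C.Index k) :
    C.Comp (fun γ => computeQ (C.size γ) (C.arr γ) (j γ) (s γ) (t γ) (k γ)) := by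
  have hB : C.Comp (fun γ => 2 ^ (C.size γ + 1)) :=
    (Comp.const 2).pow (hn.add (.const 1)).1 (hn.add (.const 1)).2
  refine Comp.mod (Comp.div ?_ (hB.pow hk.1 hk.2)) hB
  have hN := (ht.add (.const 1)).sub hs
  let M : Γ → ℕ → ℕ := fun γ v => ParkingGame.countOthers (C.size γ) (C.arr γ) (j γ) (· = v)
  have hMle : ∀ γ v, M γ v ≤ C.size γ := fun γ v => countOthers_le _ _ _ _
  -- The extra `+ 1` in the first factor leaves room for a partially added block of at most `C.size
  -- γ` copies; each entry costs at most `C.size γ + 3` bits by `enc_le`.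
  let b : Γ → ℕ := fun γ => (t γ + 1 - s γ + 1) * C.size γ * (C.size γ + 3) + 1
  have hb : C.Small b := (((hN.2.add (.const 1)).mul .size).mul (Small.size.add (.const 3))).add
    (.const 1)
  have hsize : ∀ γ (l : List ℕ), l.length ≤ (t γ + 1 - s γ + 1) * C.size γ →
      (enc (t γ) (2 ^ (C.size γ + 1)) l).size ≤ b γ := by
    intro γ l hl
    refine (Nat.size_le_size (enc_le _ _ _)).trans ((size_pow_le _ _).trans ?_)
    exact Nat.add_le_add_right (Nat.mul_le_mul hl (size_one_add_two_pow_le _)) 1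
  have hlen : ∀ γ q, q ≤ t γ + 1 - s γ → (blocks (t γ) (M γ) q).length ≤
      (t γ + 1 - s γ) * C.size γ := fun γ q hq =>
    (length_blocks_le (hMle γ) q).trans (Nat.mul_le_mul_right _ hq)
  refine Comp.iter hN.1 hN.2
    (fun γ q => enc (t γ) (2 ^ (C.size γ + 1)) (blocks (t γ) (M γ) q)) hb
    (fun γ _ q hq => hsize γ _ ((hlen γ q hq).trans (Nat.mul_le_mul_right _ (Nat.le_succ _))))
    (Comp.const 1) fun C' h hx => ?_
  have hn' := h.index_size hn
  have hM : C'.Index (fun q => M q.1 (t q.1 - q.2)) := by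
    have := Index.countOthers (p := fun q c => c = t q.1 - q.2) hn' (h.liftIndex hj)
      fun C'' h' e he => he.ite_eq (h'.lift ((h.liftIndex ht).sub (h.loopIndex hN)).1)
        (.const 1) (.const 0)
    simpa only [h.size_eq, h.arr_eq] using this
  refine Comp.iter hM.1 hM.2
    (fun q i => enc (t q.1) (2 ^ (C.size q.1 + 1))
      (List.replicate i (t q.1 - q.2) ++ blocks (t q.1) (M q.1) q.2)) (h.small hb)
    (fun q hq i hi => hsize q.1 _ ?_) hx fun C'' h' hx' => ?_
  · have h1 := hlen q.1 q.2 ((h.dom_iff q).1 hq).2.le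
    have h2 := hi.trans (hMle q.1 _)
    rw [List.length_append, List.length_replicate, Nat.succ_mul]
    omega
  · have hB' := h'.lift (h.lift hB)
    have hq := h'.liftIndex ((h.loopIndex hN).add (.const 1))
    refine (hx'.add (hB'.mul (hx'.mod (hB'.pow hq.1 hq.2)))).congr fun u hu => ?_
    -- The loop bound gives `q ≤ t`, so the exponent `t - (t - q) + 1` in `enc` is the computed `q +
    -- 1`.
    have := ((h.dom_iff _).1 ((h'.dom_iff _).1 hu).1).2
    rw [List.replicate_succ, List.cons_append, enc,
      show t u.1.1 - (t u.1.1 - u.1.2) = u.1.2 by omega]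

theorem Comp.computeR (hn : C.Index C.size) {j s t : Γ → ℕ} (hj : C.Index j) (hs : C.Index s)
    (ht : C.Index t) : C.Comp (fun γ => computeR (C.size γ) (C.arr γ) (j γ) (s γ) (t γ)) := by
  have hL : C.Index (fun γ => countOthers (C.size γ) (C.arr γ) (j γ) (fun b => t γ + 2 ≤ b)) :=
    Index.countOthers hn hj (fun γ b => t γ + 2 ≤ b) fun C' h e he =>
      ((h.lift ht.1).add (.const 2)).ite_le he (.const 1) (.const 0)
  have hG : C.Index (fun γ => countOthers (C.size γ) (C.arr γ) (j γ) (fun b => b + 2 ≤ s γ)) :=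
    Index.countOthers hn hj (fun γ b => b + 2 ≤ s γ) fun C' h e he =>
      (he.add (.const 2)).ite_le (h.lift hs.1) (.const 1) (.const 0)
  have hL1 := hL.add (.const 1)
  have hG1 := hG.add (.const 1)
  refine hL1.sum fun C' h => (h.liftIndex hG1).sum fun C'' h' => ?_
  have lift : ∀ {f : Γ → ℕ}, C.Index f → C''.Index (fun q => f q.1.1) := fun hf =>
    h'.liftIndex (h.liftIndex hf)
  have hl := h'.liftIndex (h.loopIndex hL1)
  have hg := h'.loopIndex (h.liftIndex hG1)
  have hQ := Comp.computeQ (h'.index_size (h.index_size hn)) (lift hj) (.const 1)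
    ((lift hs).sub (.const 2)) hg
  simp only [h'.size_eq, h.size_eq, h'.arr_eq, h.arr_eq] at hQ
  exact ((((lift hL).1.choose (lift hL).2 hl.1 hl.2).mul hQ).mul
    (((((lift ht).sub (lift hs)).add (.const 1)).add hl).add hg).factorial).mul
    (((lift hn).add (lift hs)).sub ((((lift ht).add hl).add hg).add (.const 2))).factorial

theorem Comp.computeNumer (hn : C.Index C.size) {j : Γ → ℕ} (hj : C.Index j) :
    C.Comp (fun γ => computeNumer (C.size γ) (C.arr γ) (j γ)) := by
  have ha := (hj.add (.const 1)).arr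
  have hd := hn.sub ha
  refine ha.sum fun C' h => (h.liftIndex hd).sum fun C'' h' => ?_
  have lift : ∀ {f : Γ → ℕ}, C.Index f → C''.Index (fun q => f q.1.1) := fun hf =>
    h'.liftIndex (h.liftIndex hf)
  have hs := (Index.const 1).add (h'.liftIndex (h.loopIndex ha))
  have hi := h'.loopIndex (h.liftIndex hd)
  have ht := (lift ha).add hi
  have hn'' := h'.index_size (h.index_size hn)
  have hQ := Comp.computeQ hn'' (lift hj) hs ht ((ht.sub hs).add (.const 1))
  have hR := Comp.computeR hn'' (lift hj) hs ht
  simp only [h'.size_eq, h.size_eq, h'.arr_eq, h.arr_eq] at hQ hR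
  exact ((hi.add (.const 1)).1.mul hQ).mul hR

end Ctx

/-! ### The program for all Shapley values -/

/-- The inputs of the Shapley value problem: parking functions. -/
abbrev Instance : Type := Σ n : ℕ, {α : Fin n → ℕ // IsParkingFunction α}

/-- The situation in which the input is stored in bank `0`, and bank `1` is reserved for the
output. -/
def inputCtx : Ctx Instance where
  size γ := γ.1
  arr γ := input γ.2.1 0
  rel γ σ := σ 0 = input γ.2.1 0
  depth := 2
  arr_eq h := h
  arr_le {γ} _ _ i := by
    simp only [input, if_true]
    split_ifs with h
    · exact le_rfl
    · rw [List.getD_eq_getElem?_getD]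
      by_cases hi : i - 1 < γ.1
      -- Preferences in a parking function are at most `n`, so they may serve as loop bounds.
      · simpa [hi] using (γ.2.2.mem_Icc ⟨i - 1, hi⟩).2
      · simp [hi]
  stable h hτ := by rw [hτ 0 (by norm_num), h]

theorem index_size_inputCtx : inputCtx.Index inputCtx.size :=
  ⟨(Ctx.Comp.const 0).arr.congr fun γ _ => input_zero γ.2.1, .size⟩

/-- One program computes the factorials and the values of the closed formula. -/
theorem exists_prog : ∃ (P : Prog) (p : Polynomial ℕ), ∀ (n : ℕ) (α : Fin n → ℕ),
    IsParkingFunction α → ∃ τ T, Run P (input α) τ T ∧ T ≤ p.eval n ∧ τ 1 0 = n.factorial ∧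
      ∀ j : Fin n, τ 1 (j + 1) = computeNumer n (input α 0) j := by
  have hn := index_size_inputCtx
  obtain ⟨PF, BF, hBF, hPF⟩ := hn.factorial.2 2 le_rfl
  obtain ⟨PN, BN, hBN, hPN⟩ := hn.1.2 2 le_rfl
  have hext := Ctx.extends_ext hn.2 (fun _ _ => 0) 2 (le_refl inputCtx.depth)
  have hnum := Ctx.Comp.computeNumer (hext.index_size hn) (hext.loopIndex hn)
  obtain ⟨p₁, hp₁⟩ := hnum.1
  obtain ⟨P, B, ⟨p₂, hp₂⟩, hP⟩ := hnum.2 5 le_rfl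
  have hFs := hn.factorial.1
  have hS : inputCtx.Small (fun γ => BF γ + ((γ.1.factorial.size + 4) + (BN γ + (3 + (3 +
      (γ.1 * ((3 * γ.1 + 5) + 1 + (p₂.eval γ.1 + ((p₁.eval γ.1 + 3 * γ.1 + 20) +
        (2 * γ.1 + 10)))) + ((3 * γ.1 + 5) + 1))))))) := by
    have hX : inputCtx.Small (fun γ => γ.1) := Ctx.Small.size
    have hE : ∀ p : Polynomial ℕ, inputCtx.Small (fun γ => p.eval γ.1) := Ctx.Small.eval
    have h3 := ((Ctx.Small.const 3).mul hX).add (Ctx.Small.const (C := inputCtx) 5)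
    have h4 := h3.add (Ctx.Small.const 1)
    have h5 := (((hE p₁).add ((Ctx.Small.const 3).mul hX)).add (Ctx.Small.const 20)).add
      (((Ctx.Small.const 2).mul hX).add (Ctx.Small.const 10))
    exact hBF.add ((hFs.add (.const 4)).add (hBN.add ((Ctx.Small.const 3).add
      ((Ctx.Small.const 3).add ((hX.mul (h4.add ((hE p₂).add h5))).add h4)))))
  obtain ⟨p, hp⟩ := hS
  -- Bank `2` first holds `n!`, which is copied to the output, and then `n`. Bank `3` is the car
  -- index, bank `4` the dummy accumulator required by `ext`, and bank `5` receives each numerator.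
  refine ⟨.seq PF (.seq (.store 1 (.const 0) (.var 2)) (.seq PN
    (.seq (.store 3 (.const 0) (.const 0)) (.seq (.store 4 (.const 0) (.const 0))
      (.loop (.sub (.var 2) (.var 3)) (.seq P
        (.seq (.store 1 (.add (.var 3) (.const 1)) (.var 5))
          (.store 3 (.const 0) (.add (.var 3) (.const 1)))))))))), p, fun n α hα => ?_⟩
  set γ : Instance := ⟨n, α, hα⟩ with hγ
  have hrel₀ : inputCtx.rel γ (input α) := rfl
  refine (?_ : ∃ τ T, _ ∧ T ≤ _ ∧ _).imp fun τ ⟨T, h1, h2, h3⟩ =>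
    ⟨T, h1, h2.trans (hp γ ⟨_, hrel₀⟩), h3⟩
  obtain ⟨τ₁, T₁, a1, a2, a3, a4⟩ := hPF γ (input α) hrel₀
  have b1 := Run.store τ₁ 1 (.const 0) (.var 2)
  rw [Expr.cost_var, a3] at b1
  set τ₂ := τ₁.write 1 _ _ with hτ₂
  have b2 : τ₂ 1 0 = n.factorial := by
    rw [hτ₂, Expr.eval_var, a3]
    exact Mem.write_self _ _ _ _
  have b3 : τ₂ 0 = input α 0 := by
    rw [hτ₂, Mem.write_of_ne _ _ _ (by norm_num), a4 0 (by norm_num)]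
  obtain ⟨τ₃, T₃, c1, c2, c3, c4⟩ := hPN γ τ₂ b3
  have d1 := Run.store τ₃ 3 (.const 0) (.const 0)
  set τ₄ := τ₃.write 3 _ _ with hτ₄
  have d2 := Run.store τ₄ 4 (.const 0) (.const 0)
  set τ₅ := τ₄.write 4 _ _ with hτ₅
  let Inv : ℕ → Mem → Prop := fun i υ => υ 0 = input α 0 ∧ υ 2 0 = n ∧ υ 3 0 = i ∧ υ 4 0 = 0 ∧
    υ 1 0 = n.factorial ∧ ∀ j < i, υ 1 (j + 1) = computeNumer n (input α 0) j
  have htest : ∀ i ≤ n, ∀ υ, Inv i υ → (Expr.sub (.var 2) (.var 3)).eval υ = n - i ∧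
      (Expr.sub (.var 2) (.var 3)).cost υ ≤ 3 * n + 5 := by
    rintro i hi υ ⟨-, e2, e3, -⟩
    rw [Expr.eval, Expr.cost, Expr.cost_var, Expr.cost_var, Expr.eval_var, Expr.eval_var, e2, e3]
    have s1 := size_le_self n
    have s2 := size_le_self i
    have s3 := size_le_self (n - i)
    exact ⟨rfl, by omega⟩
  have hInv : Inv 0 τ₅ := by
    have e : ∀ b < 3, τ₅ b = τ₃ b := fun b hb => by
      rw [hτ₅, Mem.write_of_ne _ _ _ (by omega), hτ₄, Mem.write_of_ne _ _ _ (by omega)]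
    refine ⟨?_, ?_, ?_, Mem.write_self _ _ _ _, ?_, fun j hj => by omega⟩
    · rw [e 0 (by norm_num), c4 0 (by norm_num), b3]
    · rw [e 2 (by norm_num), c3]
      rfl
    · rw [hτ₅, Mem.write_of_ne _ _ _ (by norm_num)]
      exact Mem.write_self _ _ _ _
    · rw [e 1 (by norm_num), c4 1 (by norm_num), b2]
  obtain ⟨τ, T, e1, e2, e3⟩ := run_loop (N := n) (c := 3 * n + 5)
    (c' := p₂.eval n + ((p₁.eval n + 3 * n + 20) + (2 * n + 10)))
    (e := .sub (.var 2) (.var 3)) (p := .seq P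
        (.seq (.store 1 (.add (.var 3) (.const 1)) (.var 5))
          (.store 3 (.const 0) (.add (.var 3) (.const 1))))) Inv
    (by
      intro i hi υ hυ
      obtain ⟨t1, t2⟩ := htest i hi.le υ hυ
      refine ⟨by rw [t1]; omega, t2, ?_⟩
      obtain ⟨u1, u2, u3, u4, u5, u6⟩ := hυ
      have hrel : (inputCtx.ext inputCtx.size (fun _ _ => 0) 2 le_rfl).rel (γ, i) υ :=
        ⟨u1, hi, u3, u4⟩
      obtain ⟨υ₁, S, v1, v2, v3, v4⟩ := hP (γ, i) υ hrel
      have hS : S ≤ p₂.eval n := v2.trans (hp₂ (γ, i) ⟨υ, hrel⟩)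
      have hs₁ : (computeNumer n (input α 0) i).size ≤ p₁.eval n := hp₁ (γ, i) ⟨υ, hrel⟩
      have v3' : υ₁ 5 0 = computeNumer n (input α 0) i := v3
      have w3 : υ₁ 3 0 = i := by rw [v4 3 (by norm_num), u3]
      have w3' : ∀ a v, υ₁.write 1 a v 3 0 = i := fun a v => by
        rw [Mem.write_of_ne _ _ _ (by norm_num), w3]
      have w : ∀ b < 5, b ≠ 1 → b ≠ 3 → ∀ a v a' v', (υ₁.write 1 a v).write 3 a' v' b = υ b :=
        fun b hb h1 h3 a v a' v' => by
          rw [Mem.write_of_ne _ _ _ h3, Mem.write_of_ne _ _ _ h1, v4 b hb]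
      refine ⟨_, _, .seq v1 (.seq (.store _ _ _ _) (.store _ _ _ _)), ?_, ?_⟩
      · simp only [Expr.cost, Expr.eval, Expr.cost_var, Expr.eval_var, w3, w3', v3',
          Nat.size_zero, Nat.size_one]
        have s2 := size_le_self i
        have s3 := size_le_self (i + 1)
        omega
      · simp only [Expr.eval, Expr.eval_var, w3, w3', v3']
        refine ⟨?_, ?_, Mem.write_self _ _ _ _, ?_, ?_, fun j hj => ?_⟩
        · rw [w 0 (by norm_num) (by norm_num) (by norm_num), u1]
        · rw [w 2 (by norm_num) (by norm_num) (by norm_num), u2]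
        · rw [w 4 (by norm_num) (by norm_num) (by norm_num), u4]
        · rw [Mem.write_of_ne _ _ _ (by norm_num), Mem.write_of_ne' _ _ _ (by omega),
            v4 1 (by norm_num), u5]
        · rw [Mem.write_of_ne _ _ _ (by norm_num)]
          rcases Nat.lt_succ_iff_lt_or_eq.1 hj with hj | rfl
          · rw [Mem.write_of_ne' _ _ _ (by omega), v4 1 (by norm_num), u6 j hj]
          · exact Mem.write_self _ _ _ _)
    (fun υ hυ => ⟨by rw [(htest _ le_rfl υ hυ).1, Nat.sub_self], (htest _ le_rfl υ hυ).2⟩) hInv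
  refine ⟨τ, _, .seq a1 (.seq b1 (.seq c1 (.seq d1 (.seq d2 e1)))), ?_, e3.2.2.2.2.1,
    fun j => e3.2.2.2.2.2 j j.2⟩
  simp only [Expr.cost, Nat.size_zero]
  change T₁ + (1 + 0 + (2 + n.factorial.size) + 1 + _) ≤ BF γ + (n.factorial.size + 4 +
    (BN γ + (3 + (3 + (n * ((3 * n + 5) + 1 + (p₂.eval n + ((p₁.eval n + 3 * n + 20) +
        (2 * n + 10)))) + ((3 * n + 5) + 1))))))
  omega

end ParkingGame

theorem theorem3p6 :
    -- the recursion for `Q`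
    (∀ (β : List ℕ) (s t k : ℕ), β.Pairwise (· ≤ ·) →
      ParkingGame.Q β s t k = ParkingGame.QStep β s t k) ∧
    -- the closed formula for the Shapley value of a parking game
    (∀ (n : ℕ) (α : Fin n → ℕ), ParkingGame.IsParkingFunction α → ∀ j : Fin n,
      ParkingGame.shapley (fun S => (ParkingGame.game α S : ℝ)) j =
        1 / (n.factorial : ℝ) * (ParkingGame.numer α j : ℝ)) ∧
    -- one program computes the Shapley value of all parking games in polynomial time: it writes
    -- the common denominator and the numerators, as given by the formula, into bank `1`
    (∃ (prog : ParkingGame.Prog) (bound : Polynomial ℕ),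
      ∀ (n : ℕ) (α : Fin n → ℕ), ParkingGame.IsParkingFunction α →
        ∃ (τ : ParkingGame.Mem) (T : ℕ),
          ParkingGame.Run prog (ParkingGame.input α) τ T ∧ T ≤ bound.eval n ∧
          τ 1 0 = n.factorial ∧
          ∀ j : Fin n, τ 1 (j + 1) = ParkingGame.numer α j ∧
            ParkingGame.shapley (fun S => (ParkingGame.game α S : ℝ)) j =
              (τ 1 (j + 1) : ℝ) / (τ 1 0 : ℝ)) := by
  refine ⟨fun β s t k hβ => ParkingGame.Q_eq_QStep hβ s t k,
    fun n α hα j => ParkingGame.shapley_game hα j, ?_⟩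
  obtain ⟨P, p, hP⟩ := ParkingGame.exists_prog
  refine ⟨P, p, fun n α hα => ?_⟩
  obtain ⟨τ, T, h1, h2, h3, h4⟩ := hP n α hα
  refine ⟨τ, T, h1, h2, h3, fun j => ?_⟩
  have h5 : τ 1 (j + 1) = ParkingGame.numer α j := by
    rw [h4, ParkingGame.computeNumer_eq hα]
  refine ⟨h5, ?_⟩
  rw [h5, h3, ParkingGame.shapley_game hα, one_div_mul_eq_div]
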